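/- Let $n\ge 2$, $2<p<\infty$, and put $\alpha=\frac{p-2}{n+p}$, $\beta=\frac{n+2}{p+n}=1-\alpha$. Let $\Omega\subset\mathbb R^n$ be a bounded domain satisfying the uniform exterior sphere condition, let $\varepsilon\in(0,1)$, $\Gamma_\varepsilon=\{x\in\mathbb R^n\setminus\Omega:\operatorname{dist}(x,\partial\Omega)\le\varepsilon\}$, and let $F\in C(\Gamma_\varepsilon)$. $B_t(x)$ denotes the open ball. Random step size tug-of-war with noise: a token starts at $x_0\in\Omega\cup\Gamma_\varepsilon$. In round $k+1$, with probability $\beta$ the token moves to a uniformly distributed random point of $B_\varepsilon(x_k)$. With probability $\alpha$, a step size $\varepsilon_{k+1}$, uniformly distributed on $[0,\varepsilon]$, is used and a fair coin decides which of Players I and II moves the token to a point of $B_{\varepsilon_{k+1}}(x_k)$. All random choices are independent. A strategy is a family of Borel functions giving the player's move from the history $(x_0,(c_1,\varepsilon_1,x_1),\dots,(c_k,\varepsilon_k,x_k))$ of coin tosses, step sizes and positions and from the next step size $\varepsilon_{k+1}$. The game ends at the first time $\tau\ge 0$ with $x_\tau\in\Gamma_\varepsilon$, and Player II then pays $F(x_\tau)$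 to Player I. Put $$u_{\mathrm I}^\varepsilon(x_0)=\sup_{S_{\mathrm I}}\inf_{S_{\mathrm{II}}}\mathbb E^{x_0}_{S_{\mathrm I},S_{\mathrm{II}}}[F(x_\tau)],\qquad u_{\mathrm{II}}^\varepsilon(x_0)=\inf_{S_{\mathrm{II}}}\sup_{S_{\mathrm I}}\mathbb E^{x_0}_{S_{\mathrm I},S_{\mathrm{II}}}[F(x_\tau)].$$ Theorem 4.2. For every $r>0$ there is a constant $C>0$ depending only on $p$, $n$ and $r$ such that the following holds for all $\Omega$, $\varepsilon$ and $F$ as above. Let $\nu\in\mathbb R^n$ and $b,\delta\in\mathbb R$ be such that $$|F(x)-\nu\cdot x-b|\le\delta\qquad\text{for all }x\in\Gamma_\varepsilon,$$ and let $z_0\in\mathbb R^n$ be such that $B_{6r}(z_0)\subset\Omega$. Then the game has a value $u_\varepsilon=u_{\mathrm I}^\varepsilon=u_{\mathrm{II}}^\varepsilon$ in $\Omega\cup\Gamma_\varepsilon$, and for all $x,y\in B_r(z_0)$ $$|u_\varepsilon(x)-u_\varepsilon(y)|\le(|\nu|+C\delta)\,|x-y|+(5|\nu|+C\delta)\,\varepsilon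 .$$ -/

import Mathlib

open MeasureTheory ProbabilityTheory Metric

namespace TWN

/-- The space `ℝⁿ` with its Euclidean norm. -/
abbrev Space (n : ℕ) : Type := EuclideanSpace ℝ (Fin n)

/-- The boundary strip `Γ_ε = {x ∈ ℝⁿ \ Ω : dist(x, ∂Ω) ≤ ε}`. -/
def strip {n : ℕ} (Ω : Set (Space n)) (ε : ℝ) : Set (Space n) :=
  {x | x ∉ Ω ∧ infDist x (frontier Ω) ≤ ε}

/-- Uniform exterior sphere condition: with one radius `R > 0`, every boundary point lies on the
boundary of an open ball of radius `R` that does not meet `Ω`. -/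
def UniformExteriorSphere {n : ℕ} (Ω : Set (Space n)) : Prop :=
  ∃ R : ℝ, 0 < R ∧ ∀ z ∈ frontier Ω, ∃ c : Space n, dist z c = R ∧ Disjoint (ball c R) Ω

/-- One entry `(c_i, ε_i, x_i)` of the history: the coin toss (`1`: Player I wins, `2`: Player II
wins, `0`: random step), the step size, and the position of the token. -/
abbrev Round (n : ℕ) : Type := Fin 3 × ℝ × Space n

/-- Histories `(x_0, (c_1, ε_1, x_1), …, (c_k, ε_k, x_k))` up to step `k`. The entry with index `0`
carries only the starting point `x_0`; its first two components are fixed dummies. -/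
abbrev History (n k : ℕ) : Type := (i : Finset.Iic k) → (fun _ : ℕ => Round n) i

/-- The last position `x_k` of a history up to step `k`. -/
def lastPos {n k : ℕ} (h : History n k) : Space n :=
  (h ⟨k, Finset.mem_Iic.2 le_rfl⟩).2.2

/-- A strategy: Borel functions which, from the history up to step `k` and the next step size
`s = ε_{k+1}`, give the next position in the open ball of radius `s` around `x_k`. (Nothing is
required at `s ≤ 0`, where that ball is empty; such a step size has probability zero.) -/
structure Strategy (n : ℕ) where
  move : (k : ℕ) → History n k → ℝ → Space n
  measurable_move : ∀ k, Measurable (fun q : History n k × ℝ => move k q.1 q.2)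
  move_mem : ∀ k h s, 0 < s → move k h s ∈ ball (lastPos h) s

/-- `α = (p - 2) / (n + p)`. -/
noncomputable def alpha (n : ℕ) (p : ℝ) : ℝ := (p - 2) / (n + p)

/-- `β = (n + 2) / (p + n)`. -/
noncomputable def beta (n : ℕ) (p : ℝ) : ℝ := (n + 2) / (p + n)

/-- Law of the coin tosses: `0` with probability `β`, and `1`, `2` with probability `α / 2` each. -/
noncomputable def coinLaw (n : ℕ) (p : ℝ) : Measure (Fin 3) :=
  ENNReal.ofReal (beta n p) • Measure.dirac 0 +
    ENNReal.ofReal (alpha n p / 2) • Measure.dirac 1 +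
    ENNReal.ofReal (alpha n p / 2) • Measure.dirac 2

/-- The randomness of one round: independently, the coin, a step size uniform on `[0, ε]`, and a
random displacement uniform on the ball `B_ε(0)`. -/
noncomputable def noiseLaw (n : ℕ) (p ε : ℝ) : Measure (Fin 3 × ℝ × Space n) :=
  (coinLaw n p).prod ((cond volume (Set.Icc (0 : ℝ) ε)).prod (cond volume (ball (0 : Space n) ε)))

/-- The new entry of the history, given the history, the strategies of Players I and II, and the
coin `w.1`, the step size `w.2.1` and the random displacement `w.2.2`. -/
def nextRound {n : ℕ} (S₁ S₂ : Strategy n) (k : ℕ) (h : History n k)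
    (w : Fin 3 × ℝ × Space n) : Round n :=
  (w.1, w.2.1,
    if w.1 = 0 then lastPos h + w.2.2
    else if w.1 = 1 then S₁.move k h w.2.1
    else S₂.move k h w.2.1)

/-- The one-step transition probabilities. -/
noncomputable def stepKernel {n : ℕ} (p ε : ℝ) (S₁ S₂ : Strategy n) (k : ℕ) :
    Kernel (History n k) (Round n) :=
  (Kernel.id ×ₖ Kernel.const (History n k) (noiseLaw n p ε)).map
    (fun q => nextRound S₁ S₂ k q.1 q.2)

theorem measurable_lastPos {n k : ℕ} : Measurable (lastPos : History n k → Space n) :=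
  (measurable_pi_apply (⟨k, Finset.mem_Iic.2 le_rfl⟩ : Finset.Iic k)).snd.snd

theorem measurable_nextRound {n : ℕ} (S₁ S₂ : Strategy n) (k : ℕ) :
    Measurable (fun q : History n k × (Fin 3 × ℝ × Space n) => nextRound S₁ S₂ k q.1 q.2) := by
  have hc : Measurable (fun q : History n k × (Fin 3 × ℝ × Space n) => q.2.1) :=
    measurable_snd.fst
  have hs : Measurable (fun q : History n k × (Fin 3 × ℝ × Space n) => (q.1, q.2.2.1)) :=
    measurable_fst.prodMk measurable_snd.snd.fst
  refine hc.prodMk (measurable_snd.snd.fst.prodMk ?_)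
  refine Measurable.ite (hc (measurableSet_singleton 0)) ?_
    (Measurable.ite (hc (measurableSet_singleton 1)) ?_ ?_)
  · exact (measurable_lastPos.comp measurable_fst).add measurable_snd.snd.snd
  · exact (S₁.measurable_move k).comp hs
  · exact (S₂.measurable_move k).comp hs

theorem isProbabilityMeasure_coinLaw {n : ℕ} {p : ℝ} (hp : 2 < p) :
    IsProbabilityMeasure (coinLaw n p) := by
  have hd : (0 : ℝ) < n + p := by positivity
  have ha : 0 ≤ alpha n p / 2 := by
    unfold alpha; have : 0 ≤ p - 2 := by linarith
    positivity
  have hb : 0 ≤ beta n p := by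
    unfold beta; rw [add_comm p]; positivity
  have hsum : beta n p + alpha n p / 2 + alpha n p / 2 = 1 := by
    unfold alpha beta; rw [add_comm p]; field_simp; ring
  constructor
  simp only [coinLaw, Measure.coe_add, Measure.coe_smul, Pi.add_apply, Pi.smul_apply,
    measure_univ, smul_eq_mul, mul_one]
  rw [← ENNReal.ofReal_add hb ha, ← ENNReal.ofReal_add (by positivity) ha, hsum,
    ENNReal.ofReal_one]

theorem isProbabilityMeasure_noiseLaw {n : ℕ} {p ε : ℝ} (hp : 2 < p) (hε : 0 < ε) :
    IsProbabilityMeasure (noiseLaw n p ε) := by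
  have h1 := isProbabilityMeasure_coinLaw (n := n) hp
  have h2 : IsProbabilityMeasure (cond (volume : Measure ℝ) (Set.Icc (0 : ℝ) ε)) :=
    cond_isProbabilityMeasure_of_finite (by simpa using hε) (by simp)
  have h3 : IsProbabilityMeasure (cond (volume : Measure (Space n)) (ball 0 ε)) :=
    cond_isProbabilityMeasure_of_finite (measure_ball_pos _ _ hε).ne' measure_ball_lt_top.ne
  unfold noiseLaw
  infer_instance

theorem isMarkovKernel_stepKernel {n : ℕ} {p ε : ℝ} (hp : 2 < p) (hε : 0 < ε)
    (S₁ S₂ : Strategy n) (k : ℕ) : IsMarkovKernel (stepKernel p ε S₁ S₂ k) := by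
  have := isProbabilityMeasure_noiseLaw (n := n) hp hε
  exact Kernel.IsMarkovKernel.map _ (measurable_nextRound S₁ S₂ k)

/-- The probability measure on the game trajectories for the starting point `x₀` and the strategies
`S₁` of Player I and `S₂` of Player II: the trajectory measure (Ionescu-Tulcea) of the one-step
transition probabilities. Trajectories go on after the end of the game; this part of them does not
enter the payoff. -/
noncomputable def gameMeasure {n : ℕ} {p ε : ℝ} (hp : 2 < p) (hε : 0 < ε)
    (S₁ S₂ : Strategy n) (x₀ : Space n) : Measure (ℕ → Round n) :=
  haveI := isMarkovKernel_stepKernel hp hε S₁ S₂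
  Kernel.traj (X := fun _ => Round n) (stepKernel p ε S₁ S₂) 0 (fun _ => (0, 0, x₀))

open Classical in
/-- The payoff `F(x_τ)`, where `τ` is the first time the token hits `Γ_ε` (and `0` if the game never
ends, an event of probability zero). -/
noncomputable def payoff {n : ℕ} (Ω : Set (Space n)) (ε : ℝ) (F : Space n → ℝ)
    (ω : ℕ → Round n) : ℝ :=
  if h : ∃ k, (ω k).2.2 ∈ strip Ω ε then F (ω (Nat.find h)).2.2 else 0

/-- The expected payoff `𝔼^{x₀}_{S₁,S₂}[F(x_τ)]`. -/
noncomputable def expectedPayoff {n : ℕ} {p ε : ℝ} (hp : 2 < p) (hε : 0 < ε)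
    (Ω : Set (Space n)) (F : Space n → ℝ) (x₀ : Space n) (S₁ S₂ : Strategy n) : ℝ :=
  ∫ ω, payoff Ω ε F ω ∂(gameMeasure hp hε S₁ S₂ x₀)

/-- The value of the game for Player I, `sup_{S₁} inf_{S₂} 𝔼[F(x_τ)]`. -/
noncomputable def valueI {n : ℕ} {p ε : ℝ} (hp : 2 < p) (hε : 0 < ε)
    (Ω : Set (Space n)) (F : Space n → ℝ) (x₀ : Space n) : ℝ :=
  ⨆ S₁ : Strategy n, ⨅ S₂ : Strategy n, expectedPayoff hp hε Ω F x₀ S₁ S₂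

/-- The value of the game for Player II, `inf_{S₂} sup_{S₁} 𝔼[F(x_τ)]`. -/
noncomputable def valueII {n : ℕ} {p ε : ℝ} (hp : 2 < p) (hε : 0 < ε)
    (Ω : Set (Space n)) (F : Space n → ℝ) (x₀ : Space n) : ℝ :=
  ⨅ S₂ : Strategy n, ⨆ S₁ : Strategy n, expectedPayoff hp hε Ω F x₀ S₁ S₂

end TWN

/-! The value is identified with a bounded solution `u` of the dynamic programming principle `u =
dpp p ε u` in Ω with boundary values F; the estimate is then proved for `u` without further
probability.

Solution: `exists_barrier` provides a weight φ in which one application of `dpp` shrinks differences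
that vanish outside Ω by a factor κ < 1. Iterating `dpp` from the affine function L(x) = ν·x + b
therefore converges geometrically. Since `dpp` fixes affine functions, all iterates and the limit
stay within δ of L (`exists_dpp_solution`).

Value: if one player always moves to nearly extremal points of `u`, then u(x_k) is a super- or
submartingale up to a summable error, whatever the opponent does. The same barrier shows that the
game ends almost surely (`integral_payoff_le`, `valueI_valueII_eq_of_dpp`).

Estimate: for x, y in B_l(z), compare u(x) - u(y) with W(z, l) = `oscBound`. The noise translates x,
y and z by the same vector. A supremum at x paired with an infimum at y keeps both points in
B_{l+s}(z); in the opposite pairing both can be pulled into B_{l-s}(z). So l performs a symmetric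
walk, on which the concave term -κl² gains more than the term M|z - c|² loses through the noise.
Once |z - c| ≥ r or l ≥ r, closeness to L alone bounds u(x) - u(y) by W. Hence a bound by W + m with
m ≥ 0 improves to W + m - δε² (`oscillation_bound_improve`), and finitely many improvements remove
m. Taking c = z to be the midpoint of x and y and letting l decrease to |x - y|/2 gives the theorem.
-/

namespace TWN

/-! ### The randomness of one round and the one-step formula for the game measure. -/

/-- The law of the step sizes, uniform on `[0, ε]`. -/
noncomputable def stepLaw (ε : ℝ) : Measure ℝ := cond volume (Set.Icc (0 : ℝ) ε)

/-- The law of the random displacements, uniform on `B_ε(0)`. -/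
noncomputable def ballLaw (n : ℕ) (ε : ℝ) : Measure (Space n) :=
  cond volume (ball (0 : Space n) ε)

theorem isProbabilityMeasure_stepLaw {ε : ℝ} (hε : 0 < ε) :
    IsProbabilityMeasure (stepLaw ε) :=
  cond_isProbabilityMeasure_of_finite (by simpa using hε) (by simp)

theorem isProbabilityMeasure_ballLaw {n : ℕ} {ε : ℝ} (hε : 0 < ε) :
    IsProbabilityMeasure (ballLaw n ε) :=
  cond_isProbabilityMeasure_of_finite (measure_ball_pos _ _ hε).ne' measure_ball_lt_top.ne

theorem ae_stepLaw (ε : ℝ) : ∀ᵐ s ∂(stepLaw ε), 0 < s ∧ s ≤ ε := by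
  have h1 : ∀ᵐ s ∂(stepLaw ε), s ∈ Set.Icc (0 : ℝ) ε := ae_cond_mem measurableSet_Icc
  have h2 : ∀ᵐ s ∂(stepLaw ε), s ≠ 0 := by
    have : stepLaw ε ≪ volume := cond_absolutelyContinuous
    exact this.ae_le (Measure.ae_ne volume 0)
  filter_upwards [h1, h2] with s hs h0
  exact ⟨lt_of_le_of_ne hs.1 h0.symm, hs.2⟩

theorem ae_ballLaw (n : ℕ) (ε : ℝ) : ∀ᵐ h ∂(ballLaw n ε), ‖h‖ < ε := by
  have h1 : ∀ᵐ h ∂(ballLaw n ε), h ∈ ball (0 : Space n) ε := ae_cond_mem measurableSet_ball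
  filter_upwards [h1] with h hh
  simpa using hh

theorem alpha_pos {n : ℕ} {p : ℝ} (hp : 2 < p) : 0 < alpha n p := by
  unfold alpha
  have : 0 < p - 2 := by linarith
  positivity

theorem beta_pos {n : ℕ} {p : ℝ} (hp : 2 < p) : 0 < beta n p := by
  unfold beta
  have : 0 < p := by linarith
  positivity

theorem alpha_add_beta {n : ℕ} {p : ℝ} (hp : 2 < p) : alpha n p + beta n p = 1 := by
  have hd : (0 : ℝ) < n + p := by positivity
  unfold alpha beta; rw [add_comm p]; field_simp; ring

theorem integral_coinLaw {n : ℕ} {p : ℝ} (hp : 2 < p) (g : Fin 3 → ℝ) :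
    ∫ c, g c ∂(coinLaw n p) =
      beta n p * g 0 + alpha n p / 2 * g 1 + alpha n p / 2 * g 2 := by
  have ha := (alpha_pos (n := n) hp).le
  have hb := (beta_pos (n := n) hp).le
  unfold coinLaw
  have hi : ∀ (c : ℝ) (i : Fin 3), Integrable g (ENNReal.ofReal c • Measure.dirac i) :=
    fun c i => (integrable_dirac (by simp)).smul_measure ENNReal.ofReal_ne_top
  rw [integral_add_measure ((hi _ _).add_measure (hi _ _)) (hi _ _),
    integral_add_measure (hi _ _) (hi _ _)]
  simp only [integral_smul_measure, integral_dirac, smul_eq_mul]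
  rw [ENNReal.toReal_ofReal hb, ENNReal.toReal_ofReal (by positivity)]

theorem integrable_of_bound {α : Type*} [MeasurableSpace α] {μ : Measure α} [IsFiniteMeasure μ]
    {f : α → ℝ} {B : ℝ} (hf : Measurable f) (hB : ∀ x, |f x| ≤ B) : Integrable f μ :=
  Integrable.of_bound hf.aestronglyMeasurable B (ae_of_all _ hB)

/-- Expectation, over the noise of one round, of a function that sees either the random displacement
or the step size, according to the coin. -/
theorem integral_noiseLaw {n : ℕ} {p ε : ℝ} (hp : 2 < p) (hε : 0 < ε) {B : ℝ}
    {f : Space n → ℝ} {g₁ g₂ : ℝ → ℝ} (hf : Measurable f) (hg₁ : Measurable g₁)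
    (hg₂ : Measurable g₂) (hfB : ∀ x, |f x| ≤ B) (hgB₁ : ∀ s, |g₁ s| ≤ B)
    (hgB₂ : ∀ s, |g₂ s| ≤ B) :
    ∫ w, (if w.1 = 0 then f w.2.2 else if w.1 = 1 then g₁ w.2.1 else g₂ w.2.1)
        ∂(noiseLaw n p ε) =
      beta n p * ∫ h, f h ∂(ballLaw n ε) + alpha n p / 2 * ∫ s, g₁ s ∂(stepLaw ε)
        + alpha n p / 2 * ∫ s, g₂ s ∂(stepLaw ε) := by
  have := isProbabilityMeasure_coinLaw (n := n) hp
  have := isProbabilityMeasure_stepLaw hε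
  have := isProbabilityMeasure_ballLaw (n := n) hε
  have hm : Measurable (fun w : Fin 3 × ℝ × Space n =>
      if w.1 = 0 then f w.2.2 else if w.1 = 1 then g₁ w.2.1 else g₂ w.2.1) := by
    refine Measurable.ite (measurable_fst (measurableSet_singleton 0)) (by fun_prop)
      (Measurable.ite (measurable_fst (measurableSet_singleton 1)) (by fun_prop) (by fun_prop))
  change ∫ w, _ ∂((coinLaw n p).prod ((stepLaw ε).prod (ballLaw n ε))) = _
  rw [integral_prod _ (integrable_of_bound (B := B) hm (fun w => by split_ifs <;> simp [*])),
    integral_coinLaw hp]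
  congr 1
  · congr 1
    · congr 1
      simpa using integral_fun_snd (μ := stepLaw ε) (ν := ballLaw n ε) f
    · congr 1
      simpa using integral_fun_fst (μ := stepLaw ε) (ν := ballLaw n ε) g₁
  · congr 1
    simpa using integral_fun_fst (μ := stepLaw ε) (ν := ballLaw n ε) g₂

theorem isProbabilityMeasure_gameMeasure {n : ℕ} {p ε : ℝ} (hp : 2 < p) (hε : 0 < ε)
    (S₁ S₂ : Strategy n) (x₀ : Space n) :
    IsProbabilityMeasure (gameMeasure hp hε S₁ S₂ x₀) := by
  have := isMarkovKernel_stepKernel hp hε S₁ S₂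
  unfold gameMeasure
  infer_instance

/-- The position of the token after `k` rounds. -/
def pos {n : ℕ} (k : ℕ) (ω : ℕ → Round n) : Space n := (ω k).2.2

theorem measurable_pos {n : ℕ} (k : ℕ) : Measurable (pos k : (ℕ → Round n) → Space n) :=
  (measurable_pi_apply k).snd.snd

theorem pos_zero_ae {n : ℕ} {p ε : ℝ} (hp : 2 < p) (hε : 0 < ε)
    (S₁ S₂ : Strategy n) (x₀ : Space n) :
    ∀ᵐ ω ∂(gameMeasure hp hε S₁ S₂ x₀), pos 0 ω = x₀ := by
  have := isMarkovKernel_stepKernel hp hε S₁ S₂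
  have h := Kernel.traj_map_frestrictLe_apply (X := fun _ => Round n)
    (κ := stepKernel p ε S₁ S₂) 0 0 (fun _ => (0, 0, x₀))
  rw [Kernel.partialTraj_self, Kernel.id_apply] at h
  have h2 : ∀ᵐ y ∂(Measure.dirac (fun _ : Finset.Iic 0 => ((0, 0, x₀) : Round n))),
      lastPos y = x₀ := by
    exact (ae_dirac_iff (measurable_lastPos (measurableSet_singleton x₀))).2 rfl
  rw [← h] at h2
  exact ae_of_ae_map (Preorder.measurable_frestrictLe 0).aemeasurable h2

/-- One-step formula: the entry of index `k + 1` is obtained from the history up to step `k` and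
independent noise. -/
theorem integral_gameMeasure_succ {n : ℕ} {p ε : ℝ} (hp : 2 < p) (hε : 0 < ε)
    (S₁ S₂ : Strategy n) (x₀ : Space n) (k : ℕ) {B : ℝ} {ψ : History n k × Round n → ℝ}
    (hψ : Measurable ψ) (hB : ∀ q, |ψ q| ≤ B) :
    ∫ ω, ψ (Preorder.frestrictLe k ω, ω (k + 1)) ∂(gameMeasure hp hε S₁ S₂ x₀) =
      ∫ ω, (∫ w, ψ (Preorder.frestrictLe k ω,
        nextRound S₁ S₂ k (Preorder.frestrictLe k ω) w) ∂(noiseLaw n p ε))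
          ∂(gameMeasure hp hε S₁ S₂ x₀) := by
  have := isMarkovKernel_stepKernel hp hε S₁ S₂
  have := isProbabilityMeasure_noiseLaw (n := n) hp hε
  -- The joint law of the history and the next entry is the composition product of the law of the
  -- history with the one-step kernel.
  have h1 := Kernel.partialTraj_compProd_eq_map_traj (X := fun _ => Round n)
    (κ := stepKernel p ε S₁ S₂) (Nat.zero_le k) (x₀ := fun _ => (0, 0, x₀))
  rw [← Kernel.traj_map_frestrictLe_apply] at h1
  have hstep : ∀ h, ∫ r, ψ (h, r) ∂(stepKernel p ε S₁ S₂ k h) =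
      ∫ w, ψ (h, nextRound S₁ S₂ k h w) ∂(noiseLaw n p ε) := by
    intro h
    have hm := measurable_nextRound S₁ S₂ k
    have : stepKernel p ε S₁ S₂ k h = (noiseLaw n p ε).map (nextRound S₁ S₂ k h) := by
      unfold stepKernel
      rw [Kernel.map_apply _ hm, Kernel.prod_apply, Kernel.id_apply, Kernel.const_apply,
        Measure.dirac_prod, Measure.map_map hm (by fun_prop)]
      rfl
    have hm' : Measurable (nextRound S₁ S₂ k h) := hm.comp measurable_prodMk_left
    rw [this, integral_map hm'.aemeasurable]
    exact (hψ.comp measurable_prodMk_left).aestronglyMeasurable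
  have hmr : Measurable (Preorder.frestrictLe (π := fun _ : ℕ => Round n) k) :=
    Preorder.measurable_frestrictLe k
  calc _ = ∫ q, ψ q ∂((gameMeasure hp hε S₁ S₂ x₀).map
        (fun ω => (Preorder.frestrictLe k ω, ω (k + 1)))) := by
        rw [integral_map (by fun_prop) hψ.aestronglyMeasurable]
    _ = _ := by
        unfold gameMeasure
        rw [← h1, Measure.integral_compProd (integrable_of_bound hψ hB),
          integral_map hmr.aemeasurable]
        · simp_rw [hstep]
        · exact (hψ.stronglyMeasurable.integral_kernel_prod_right').aestronglyMeasurable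


/-! ### Suprema and infima over balls, and measurable selection of near-maximizers. -/

/-- The supremum of `v` on the ball `B_s(x)`. -/
noncomputable def ballSup {n : ℕ} (v : Space n → ℝ) (x : Space n) (s : ℝ) : ℝ :=
  sSup (v '' ball x s)

/-- The infimum of `v` on the ball `B_s(x)`. -/
noncomputable def ballInf {n : ℕ} (v : Space n → ℝ) (x : Space n) (s : ℝ) : ℝ :=
  -ballSup (fun y => -v y) x s

theorem le_ballSup {n : ℕ} {v : Space n → ℝ} {B : ℝ} (hB : ∀ x, |v x| ≤ B) {x y : Space n}
    {s : ℝ} (hy : y ∈ ball x s) : v y ≤ ballSup v x s :=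
  le_csSup ⟨B, by rintro _ ⟨z, -, rfl⟩; exact (abs_le.1 (hB z)).2⟩ (Set.mem_image_of_mem v hy)

theorem ballSup_le {n : ℕ} {v : Space n → ℝ} {c : ℝ} {x : Space n} {s : ℝ} (hs : 0 < s)
    (h : ∀ y ∈ ball x s, v y ≤ c) : ballSup v x s ≤ c :=
  csSup_le ((nonempty_ball.2 hs).image v) (by rintro _ ⟨z, hz, rfl⟩; exact h z hz)

theorem ballInf_le {n : ℕ} {v : Space n → ℝ} {B : ℝ} (hB : ∀ x, |v x| ≤ B) {x y : Space n}
    {s : ℝ} (hy : y ∈ ball x s) : ballInf v x s ≤ v y := by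
  have := le_ballSup (v := fun y => -v y) (B := B) (by simpa using hB) hy
  unfold ballInf; linarith

theorem le_ballInf {n : ℕ} {v : Space n → ℝ} {c : ℝ} {x : Space n} {s : ℝ} (hs : 0 < s)
    (h : ∀ y ∈ ball x s, c ≤ v y) : c ≤ ballInf v x s := by
  have := ballSup_le (v := fun y => -v y) (c := -c) hs (fun y hy => neg_le_neg (h y hy))
  unfold ballInf; linarith

theorem ballSup_of_nonpos {n : ℕ} (v : Space n → ℝ) (x : Space n) {s : ℝ} (hs : s ≤ 0) :
    ballSup v x s = 0 := by
  simp [ballSup, ball_eq_empty.2 hs]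

theorem ballInf_neg {n : ℕ} (v : Space n → ℝ) (x : Space n) (s : ℝ) :
    ballInf (fun y => -v y) x s = -ballSup v x s := by
  simp [ballInf]

theorem abs_ballSup_le {n : ℕ} {v : Space n → ℝ} {B : ℝ} (hB : ∀ x, |v x| ≤ B) (x : Space n)
    (s : ℝ) : |ballSup v x s| ≤ B := by
  rcases le_or_gt s 0 with hs | hs
  · rw [ballSup_of_nonpos v x hs, abs_zero]
    exact (abs_nonneg _).trans (hB x)
  · rw [abs_le]
    exact ⟨(abs_le.1 (hB x)).1.trans (le_ballSup hB (mem_ball_self hs)),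
      ballSup_le hs fun y _ => (abs_le.1 (hB y)).2⟩

theorem abs_ballInf_le {n : ℕ} {v : Space n → ℝ} {B : ℝ} (hB : ∀ x, |v x| ≤ B) (x : Space n)
    (s : ℝ) : |ballInf v x s| ≤ B := by
  rw [ballInf, abs_neg]
  exact abs_ballSup_le (by simpa using hB) x s

/-- For s > 0 the superlevel sets are open: a witness y stays in the ball when (x, s) moves
slightly. No regularity of v enters. The second set in the union accounts for the default value 0 on
empty balls. -/
theorem measurable_ballSup {n : ℕ} {v : Space n → ℝ} {B : ℝ} (hB : ∀ x, |v x| ≤ B) :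
    Measurable (fun q : Space n × ℝ => ballSup v q.1 q.2) := by
  refine measurable_of_Ioi fun c => ?_
  have hopen : IsOpen {q : Space n × ℝ | ∃ y ∈ ball q.1 q.2, c < v y} := by
    have : {q : Space n × ℝ | ∃ y ∈ ball q.1 q.2, c < v y} =
        ⋃ y ∈ {y | c < v y}, {q : Space n × ℝ | dist y q.1 < q.2} := by
      ext q; simp [and_comm]
    rw [this]
    exact isOpen_biUnion fun y _ => isOpen_lt (by fun_prop) (by fun_prop)
  have : (fun q : Space n × ℝ => ballSup v q.1 q.2) ⁻¹' Set.Ioi c =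
      {q : Space n × ℝ | ∃ y ∈ ball q.1 q.2, c < v y} ∪
        {q : Space n × ℝ | q.2 ≤ 0 ∧ c < 0} := by
    ext ⟨x, s⟩
    simp only [Set.mem_preimage, Set.mem_Ioi, Set.mem_union, Set.mem_ofPred_eq]
    constructor
    · intro h
      rcases le_or_gt s 0 with hs | hs
      · rw [ballSup_of_nonpos v x hs] at h
        exact Or.inr ⟨hs, h⟩
      · left
        by_contra! hc
        exact absurd (ballSup_le hs hc) (not_le.2 h)
    · rintro (⟨y, hy, hc⟩ | ⟨hs, hc⟩)
      · exact hc.trans_le (le_ballSup hB hy)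
      · rwa [ballSup_of_nonpos v x hs]
  rw [this]
  exact hopen.measurableSet.union
    ((measurableSet_le measurable_snd measurable_const).inter (MeasurableSet.const _))

theorem measurable_ballInf {n : ℕ} {v : Space n → ℝ} {B : ℝ} (hB : ∀ x, |v x| ≤ B) :
    Measurable (fun q : Space n × ℝ => ballInf v q.1 q.2) :=
  (measurable_ballSup (v := fun y => -v y) (B := B) (by simpa using hB)).neg

/-- Any real function on `ℝⁿ` has a sequence of points that exhausts its values on all open sets
from below. -/
theorem exists_seq_dense_values {n : ℕ} (v : Space n → ℝ) :
    ∃ d : ℕ → Space n, ∀ U : Set (Space n), IsOpen U → ∀ y ∈ U, ∀ c < v y,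
      ∃ i, d i ∈ U ∧ c < v (d i) := by
  -- The graph of v is separable as a subspace of ℝⁿ × ℝ. A dense sequence in it approximates
  -- position and value at once, although v need not be continuous.
  let g := Set.range (fun y : Space n => (y, v y))
  have : Nonempty g := ⟨⟨_, 0, rfl⟩⟩
  obtain ⟨e, he⟩ := TopologicalSpace.exists_dense_seq g
  refine ⟨fun i => (e i).1.1, fun U hU y hy c hc => ?_⟩
  have ho : IsOpen {q : g | q.1.1 ∈ U ∧ c < q.1.2} :=
    (hU.preimage (continuous_fst.comp continuous_subtype_val)).inter
      (isOpen_lt continuous_const (continuous_snd.comp continuous_subtype_val))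
  obtain ⟨i, hi⟩ := he.exists_mem_open ho ⟨⟨(y, v y), y, rfl⟩, hy, hc⟩
  refine ⟨i, hi.1, ?_⟩
  obtain ⟨z, hz⟩ := (e i).2
  have h2 := hi.2
  have h3 : (e i).1.2 = v (e i).1.1 := by rw [← hz]
  exact h3 ▸ h2

/-- Measurable selection of near-maximum points in balls. -/
theorem exists_measurable_selector {n : ℕ} {v : Space n → ℝ} {B : ℝ}
    (hB : ∀ x, |v x| ≤ B) {η : ℝ} (hη : 0 < η) :
    ∃ σ : Space n × ℝ → Space n, Measurable σ ∧ ∀ x s, 0 < s →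
      σ (x, s) ∈ ball x s ∧ ballSup v x s - η ≤ v (σ (x, s)) := by
  classical
  obtain ⟨d, hd⟩ := exists_seq_dense_values v
  -- The first admissible index is a measurable choice. The alternative `q.2 ≤ 0` only makes the
  -- search total.
  let P : ℕ → Space n × ℝ → Prop :=
    fun i q => q.2 ≤ 0 ∨ (dist (d i) q.1 < q.2 ∧ ballSup v q.1 q.2 - η ≤ v (d i))
  have hP : ∀ q, ∃ i, P i q := by
    rintro ⟨x, s⟩
    rcases le_or_gt s 0 with hs | hs
    · exact ⟨0, Or.inl hs⟩
    · obtain ⟨y, hy, hc⟩ : ∃ y ∈ ball x s, ballSup v x s - η < v y := by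
        by_contra! hc
        linarith [ballSup_le hs hc]
      obtain ⟨i, hi, hc'⟩ := hd _ isOpen_ball y hy _ hc
      exact ⟨i, Or.inr ⟨hi, hc'.le⟩⟩
  have hPm : ∀ i, MeasurableSet {q | P i q} := fun i =>
    (measurableSet_le measurable_snd measurable_const).union
      ((measurableSet_lt (by fun_prop) measurable_snd).inter
        (measurableSet_le ((measurable_ballSup hB).sub_const η) measurable_const))
  refine ⟨fun q => d (Nat.find (hP q)), (measurable_from_nat).comp (measurable_find hP hPm), ?_⟩
  intro x s hs
  rcases Nat.find_spec (hP (x, s)) with h | h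
  · exact absurd h (not_le.2 hs)
  · exact h

/-- The strategy that moves to a point selected from the current position and the step size. -/
def selectorStrategy {n : ℕ} (σ : ℕ → Space n × ℝ → Space n) (hσ : ∀ k, Measurable (σ k))
    (hmem : ∀ k x s, 0 < s → σ k (x, s) ∈ ball x s) : Strategy n where
  move k h s := σ k (lastPos h, s)
  measurable_move k :=
    (hσ k).comp ((measurable_lastPos.comp measurable_fst).prodMk measurable_snd)
  move_mem k h s hs := hmem k (lastPos h) s hs

/-! ### The dynamic programming operator. -/

/-- The right-hand side of the dynamic programming principle of the game. -/
noncomputable def dpp {n : ℕ} (p ε : ℝ) (v : Space n → ℝ) (x : Space n) : ℝ :=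
  beta n p * ∫ h, v (x + h) ∂(ballLaw n ε) +
    alpha n p / 2 * ∫ s, (ballSup v x s + ballInf v x s) ∂(stepLaw ε)

theorem measurable_dpp {n : ℕ} {p ε : ℝ} (hε : 0 < ε) {v : Space n → ℝ} (hv : Measurable v)
    {B : ℝ} (hB : ∀ x, |v x| ≤ B) : Measurable (dpp p ε v) := by
  have := isProbabilityMeasure_stepLaw hε
  have := isProbabilityMeasure_ballLaw (n := n) hε
  have h1 : Measurable (fun x => ∫ h, v (x + h) ∂(ballLaw n ε)) := by
    have : Measurable (fun q : Space n × Space n => v (q.1 + q.2)) := by fun_prop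
    exact (this.stronglyMeasurable.integral_prod_right' (ν := ballLaw n ε)).measurable
  have h2 : Measurable (fun x => ∫ s, (ballSup v x s + ballInf v x s) ∂(stepLaw ε)) :=
    (((measurable_ballSup hB).add (measurable_ballInf hB)).stronglyMeasurable.integral_prod_right'
      (ν := stepLaw ε)).measurable
  exact (h1.const_mul _).add (h2.const_mul _)

theorem dpp_neg {n : ℕ} (p ε : ℝ) (v : Space n → ℝ) (x : Space n) :
    dpp p ε (fun y => -v y) x = -dpp p ε v x := by
  have : ∀ s, ballSup (fun y => -v y) x s + ballInf (fun y => -v y) x s =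
      -(ballSup v x s + ballInf v x s) := by
    intro s; rw [ballInf_neg, ballInf]; ring
  simp only [dpp, this, integral_neg]
  ring

theorem integrable_ballSup_add_ballInf {n : ℕ} {ε : ℝ} (hε : 0 < ε) {v : Space n → ℝ}
    {B : ℝ} (hB : ∀ x, |v x| ≤ B) (x : Space n) :
    Integrable (fun s => ballSup v x s + ballInf v x s) (stepLaw ε) := by
  have := isProbabilityMeasure_stepLaw hε
  have h1 : Measurable (fun s => ballSup v x s) :=
    Measurable.of_uncurry_left (f := ballSup v) (measurable_ballSup hB)
  have h2 : Measurable (fun s => ballInf v x s) :=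
    Measurable.of_uncurry_left (f := ballInf v) (measurable_ballInf hB)
  have i1 : Integrable (fun s => ballSup v x s) (stepLaw ε) :=
    integrable_of_bound h1 (abs_ballSup_le hB x)
  have i2 : Integrable (fun s => ballInf v x s) (stepLaw ε) :=
    integrable_of_bound h2 (abs_ballInf_le hB x)
  exact i1.add i2

theorem integral_le_of_ae_le_const {α : Type*} [MeasurableSpace α] {μ : Measure α}
    [IsProbabilityMeasure μ] {f : α → ℝ} (hf : Integrable f μ) {c : ℝ} (h : ∀ᵐ x ∂μ, f x ≤ c) :
    ∫ x, f x ∂μ ≤ c := by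
  have := integral_mono_ae hf (integrable_const c) h
  simpa using this

/-- Integration of bounds for the noise and the tug-of-war part of the game separately. -/
theorem dpp_le {n : ℕ} {p ε : ℝ} (hp : 2 < p) (hε : 0 < ε) {v : Space n → ℝ} (hv : Measurable v)
    {B : ℝ} (hB : ∀ x, |v x| ≤ B) {x : Space n} {ψ : Space n → ℝ}
    (hψ : Integrable ψ (ballLaw n ε)) {c : ℝ} (h₁ : ∀ h, ‖h‖ < ε → v (x + h) ≤ ψ h)
    (h₂ : ∀ s, 0 < s → s ≤ ε → ballSup v x s + ballInf v x s ≤ 2 * c) :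
    dpp p ε v x ≤ beta n p * ∫ h, ψ h ∂(ballLaw n ε) + alpha n p * c := by
  have := isProbabilityMeasure_stepLaw hε
  have := isProbabilityMeasure_ballLaw (n := n) hε
  have e1 : ∫ h, v (x + h) ∂(ballLaw n ε) ≤ ∫ h, ψ h ∂(ballLaw n ε) := by
    refine integral_mono_ae (integrable_of_bound (B := B) (by fun_prop) fun h => hB _) hψ ?_
    filter_upwards [ae_ballLaw n ε] with h hh using h₁ h hh
  have e2 : ∫ s, (ballSup v x s + ballInf v x s) ∂(stepLaw ε) ≤ 2 * c := by
    refine integral_le_of_ae_le_const (integrable_ballSup_add_ballInf hε hB x) ?_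
    filter_upwards [ae_stepLaw ε] with s hs using h₂ s hs.1 hs.2
  have ha := alpha_pos (n := n) hp
  have hb := beta_pos (n := n) hp
  unfold dpp
  calc _ ≤ beta n p * ∫ h, ψ h ∂(ballLaw n ε) + alpha n p / 2 * (2 * c) := by gcongr
    _ = _ := by ring

theorem abs_dpp_le {n : ℕ} {p ε : ℝ} (hp : 2 < p) (hε : 0 < ε) {v : Space n → ℝ}
    (hv : Measurable v) {B : ℝ} (hB : ∀ x, |v x| ≤ B) (x : Space n) : |dpp p ε v x| ≤ B := by
  have := isProbabilityMeasure_ballLaw (n := n) hε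
  have key : ∀ w : Space n → ℝ, Measurable w → (∀ x, |w x| ≤ B) → dpp p ε w x ≤ B := by
    intro w hw hB
    have := dpp_le hp hε hw hB (x := x) (ψ := fun _ => B) (integrable_const _) (c := B)
      (fun h _ => (abs_le.1 (hB _)).2) (fun s _ _ => by
        linarith [(abs_le.1 (abs_ballSup_le hB x s)).2, (abs_le.1 (abs_ballInf_le hB x s)).2])
    refine this.trans (le_of_eq ?_)
    have hab := alpha_add_beta (n := n) hp
    simp only [integral_const, probReal_univ, smul_eq_mul, one_mul]
    rw [← add_mul, add_comm, hab, one_mul]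
  have h1 := key v hv hB
  have h2 := key (fun y => -v y) hv.neg (by simpa using hB)
  rw [dpp_neg] at h2
  exact abs_le.2 ⟨by linarith, h1⟩

theorem ballSup_sub_le {n : ℕ} {v w : Space n → ℝ} {B : ℝ} (hw : ∀ x, |w x| ≤ B)
    {x : Space n} {s c : ℝ} (hs : 0 < s) (h : ∀ y ∈ ball x s, v y - w y ≤ c) :
    ballSup v x s - ballSup w x s ≤ c := by
  have : ballSup v x s ≤ ballSup w x s + c :=
    ballSup_le hs fun y hy => by linarith [h y hy, le_ballSup hw hy]
  linarith

/-- Suprema, and likewise infima, of two functions over a ball differ by at most the bound c on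
their difference. The noise term keeps its average against ψ; this is where a contraction can come
from. -/
theorem dpp_sub_le {n : ℕ} {p ε : ℝ} (hp : 2 < p) (hε : 0 < ε) {v w : Space n → ℝ}
    (hv : Measurable v) (hw : Measurable w)
    {B : ℝ} (hvB : ∀ x, |v x| ≤ B) (hwB : ∀ x, |w x| ≤ B) {x : Space n} {ψ : Space n → ℝ}
    (hψ : Integrable ψ (ballLaw n ε)) {c : ℝ} (h₁ : ∀ h, ‖h‖ < ε → v (x + h) - w (x + h) ≤ ψ h)
    (h₂ : ∀ y ∈ ball x ε, v y - w y ≤ c) :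
    dpp p ε v x - dpp p ε w x ≤ beta n p * ∫ h, ψ h ∂(ballLaw n ε) + alpha n p * c := by
  have := isProbabilityMeasure_stepLaw hε
  have := isProbabilityMeasure_ballLaw (n := n) hε
  have iv : Integrable (fun h => v (x + h)) (ballLaw n ε) :=
    integrable_of_bound (B := B) (by fun_prop) fun h => hvB _
  have iw : Integrable (fun h => w (x + h)) (ballLaw n ε) :=
    integrable_of_bound (B := B) (by fun_prop) fun h => hwB _
  have isv := integrable_ballSup_add_ballInf hε hvB x
  have isw := integrable_ballSup_add_ballInf hε hwB x
  have e1 : ∫ h, v (x + h) ∂(ballLaw n ε) - ∫ h, w (x + h) ∂(ballLaw n ε) ≤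
      ∫ h, ψ h ∂(ballLaw n ε) := by
    rw [← integral_sub iv iw]
    refine integral_mono_ae (iv.sub iw) hψ ?_
    filter_upwards [ae_ballLaw n ε] with h hh using h₁ h hh
  have e2 : ∫ s, (ballSup v x s + ballInf v x s) ∂(stepLaw ε) -
      ∫ s, (ballSup w x s + ballInf w x s) ∂(stepLaw ε) ≤ 2 * c := by
    rw [← integral_sub isv isw]
    refine integral_le_of_ae_le_const (isv.sub isw) ?_
    filter_upwards [ae_stepLaw ε] with s hs
    have hsub : ball x s ⊆ ball x ε := ball_subset_ball hs.2
    have a1 := ballSup_sub_le hwB hs.1 fun y hy => h₂ y (hsub hy)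
    have a2 := ballSup_sub_le (v := fun y => -w y) (w := fun y => -v y) (B := B) (c := c)
      (by simpa using hvB) hs.1 fun y hy => by linarith [h₂ y (hsub hy)]
    simp only [ballInf, Pi.sub_apply]
    linarith
  have ha := alpha_pos (n := n) hp
  have hb := beta_pos (n := n) hp
  unfold dpp
  have e1' := mul_le_mul_of_nonneg_left e1 hb.le
  have e2' := mul_le_mul_of_nonneg_left e2 (half_pos ha).le
  linarith

/-! ### The barrier. -/

/-- A bounded positive function that decreases on average along the game inside a given ball,
whatever the players do. -/
theorem exists_barrier {n : ℕ} (hn : 2 ≤ n) {p ε : ℝ} (hp : 2 < p) (hε : 0 < ε)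
    (R : ℝ) :
    ∃ (φ : Space n → ℝ) (E κ : ℝ), Continuous φ ∧ 0 < κ ∧ κ < 1 ∧
      (∀ x, ‖x‖ ≤ R + ε → 1 ≤ φ x ∧ φ x ≤ E) ∧
      ∀ x, ‖x‖ ≤ R → beta n p * ∫ h, φ (x + h) ∂(ballLaw n ε) + alpha n p * E ≤ κ * φ x := by
  have := isProbabilityMeasure_ballLaw (n := n) hε
  have hb := beta_pos (n := n) hp
  have hab := alpha_add_beta (n := n) hp
  let e : Space n := EuclideanSpace.single ⟨0, by omega⟩ 1
  have he : ‖e‖ = 1 := by simp [e]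
  have hle : ∀ x : Space n, |inner ℝ e x| ≤ ‖x‖ := fun x => by
    simpa [he] using abs_real_inner_le_norm e x
  -- On U one has ⟨e, h⟩ ≥ ε/4, so the exponential moment of ⟨e, h⟩ is at least exp(lε/4) times the
  -- mass of U; a large l brings it above 2/β.
  let U : Set (Space n) := ball ((ε / 2) • e) (ε / 4)
  have hUsub : U ⊆ ball 0 ε := by
    refine ball_subset_ball' ?_
    rw [dist_zero_right, norm_smul, he, Real.norm_of_nonneg (by positivity)]
    linarith
  have hU : 0 < (ballLaw n ε).real U := by
    refine ENNReal.toReal_pos ?_ (measure_ne_top _ _)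
    unfold ballLaw
    rw [cond_apply measurableSet_ball, Set.inter_eq_right.2 hUsub]
    exact mul_ne_zero (ENNReal.inv_ne_zero.2 measure_ball_lt_top.ne)
      (measure_ball_pos _ _ (by positivity)).ne'
  obtain ⟨l, hl0, hl⟩ : ∃ l : ℝ, 0 < l ∧
      2 / (beta n p * (ballLaw n ε).real U) ≤ Real.exp (l * (ε / 4)) := by
    have ht : Filter.Tendsto (fun l : ℝ => Real.exp (l * (ε / 4))) Filter.atTop Filter.atTop :=
      Real.tendsto_exp_atTop.comp (Filter.tendsto_id.atTop_mul_const (by positivity))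
    exact ((Filter.eventually_gt_atTop 0).and (ht.eventually_ge_atTop _)).exists
  have hc : Continuous fun x : Space n => Real.exp (l * inner ℝ e x) := by fun_prop
  have hint : Integrable (fun h : Space n => Real.exp (l * inner ℝ e h)) (ballLaw n ε) := by
    refine Integrable.of_bound hc.aestronglyMeasurable (Real.exp (l * ε)) ?_
    filter_upwards [ae_ballLaw n ε] with h hh
    rw [Real.norm_of_nonneg (Real.exp_pos _).le]
    gcongr
    exact (le_abs_self _).trans ((hle h).trans hh.le)
  have hI : 2 ≤ beta n p * ∫ h, Real.exp (l * inner ℝ e h) ∂(ballLaw n ε) := by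
    have h1 : Real.exp (l * (ε / 4)) * (ballLaw n ε).real U ≤
        ∫ h, Real.exp (l * inner ℝ e h) ∂(ballLaw n ε) := by
      calc _ = ∫ _ in U, Real.exp (l * (ε / 4)) ∂(ballLaw n ε) := by
            simp [mul_comm]
        _ ≤ ∫ h in U, Real.exp (l * inner ℝ e h) ∂(ballLaw n ε) := by
            refine setIntegral_mono_on (integrable_const _).integrableOn hint.integrableOn
              measurableSet_ball fun h hh => ?_
            gcongr
            have h2 : inner ℝ e h = ε / 2 + inner ℝ e (h - (ε / 2) • e) := by
              rw [inner_sub_right, inner_smul_right, real_inner_self_eq_norm_sq, he]; ring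
            have h3 := (abs_le.1 (hle (h - (ε / 2) • e))).1
            rw [mem_ball, dist_eq_norm] at hh
            linarith
        _ ≤ _ := setIntegral_le_integral hint (ae_of_all _ fun h => (Real.exp_pos _).le)
    rw [div_le_iff₀ (by positivity)] at hl
    nlinarith
  have hexp : ∀ x : Space n, ‖x‖ ≤ R + ε →
      Real.exp (-(l * (R + ε))) ≤ Real.exp (l * inner ℝ e x) ∧
      Real.exp (l * inner ℝ e x) ≤ Real.exp (l * (R + ε)) := fun x hx => by
    have := abs_le.1 ((hle x).trans hx)
    constructor <;> gcongr <;> nlinarith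
  set E := Real.exp (l * (R + ε)) + 1 with hE
  have hE1 : 1 < E := by linarith [Real.exp_pos (l * (R + ε))]
  set m := Real.exp (-(l * (R + ε))) with hm
  have hm0 : 0 < m := Real.exp_pos _
  -- The players may push φ up to E, so the decrease must come from the noise. With I the
  -- exponential moment, the left side is E - βI exp(l⟨e, x⟩) ≤ φ(x) - exp(l⟨e, x⟩) ≤ φ(x) - m, and
  -- φ ≤ E turns this into (1 - m/E)φ(x). The maximum with 1/2 only ensures κ > 0.
  refine ⟨fun x => E - Real.exp (l * inner ℝ e x), E, max (1 / 2) (1 - m / E), by fun_prop,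
    by positivity, max_lt (by norm_num) (by have : 0 < m / E := by positivity
                                            linarith), fun x hx => ?_, fun x hx => ?_⟩
  · have := hexp x hx
    constructor <;> linarith
  · have hx' := hexp x (by linarith)
    have h1 : ∫ h, (E - Real.exp (l * inner ℝ e (x + h))) ∂(ballLaw n ε) =
        E - Real.exp (l * inner ℝ e x) * ∫ h, Real.exp (l * inner ℝ e h) ∂(ballLaw n ε) := by
      simp only [inner_add_right, mul_add, Real.exp_add]
      rw [integral_sub (integrable_const _) (hint.const_mul _), integral_const_mul]
      simp
    simp only [h1]
    have hmax : 1 - m / E ≤ max (1 / 2) (1 - m / E) := le_max_right _ _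
    have hφ : 0 ≤ E - Real.exp (l * inner ℝ e x) := by linarith
    have h2 : (1 - m / E) * (E - Real.exp (l * inner ℝ e x)) ≤
      max (1 / 2) (1 - m / E) * (E - Real.exp (l * inner ℝ e x)) := by gcongr
    have h3 : E - 2 * Real.exp (l * inner ℝ e x) ≤
        (1 - m / E) * (E - Real.exp (l * inner ℝ e x)) := by
      have : m / E * E = m := by field_simp
      have : 0 ≤ m / E * Real.exp (l * inner ℝ e x) := by positivity
      nlinarith
    have h4 := mul_le_mul_of_nonneg_left hI (Real.exp_pos (l * inner ℝ e x)).le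
    have h5 : beta n p * E + alpha n p * E = E := by rw [← add_mul, add_comm, hab, one_mul]
    nlinarith


/-! ### Affine functions under the operator. -/

theorem measurePreserving_neg_ballLaw (n : ℕ) (ε : ℝ) :
    MeasurePreserving (MeasurableEquiv.neg (Space n)) (ballLaw n ε) (ballLaw n ε) := by
  have h := (Measure.measurePreserving_neg (volume : Measure (Space n))).restrict_preimage
    (measurableSet_ball (x := (0 : Space n)) (ε := ε))
  have hpre : (Neg.neg : Space n → Space n) ⁻¹' ball 0 ε = ball 0 ε := by
    ext x; simp
  rw [hpre] at h
  exact h.smul_measure _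

theorem integrable_ballLaw_of_continuous {n : ℕ} {ε : ℝ} (hε : 0 < ε) {f : Space n → ℝ}
    (hf : Continuous f) : Integrable f (ballLaw n ε) := by
  have := isProbabilityMeasure_ballLaw (n := n) hε
  obtain ⟨C, hC⟩ := (isCompact_closedBall (0 : Space n) ε).exists_bound_of_continuousOn
    hf.continuousOn
  refine Integrable.of_bound hf.aestronglyMeasurable C ?_
  filter_upwards [ae_ballLaw n ε] with h hh
  exact hC h (by simpa using hh.le)

theorem integral_inner_ballLaw (n : ℕ) (ε : ℝ) (ν : Space n) :
    ∫ h, inner ℝ ν h ∂(ballLaw n ε) = 0 := by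
  have h := (measurePreserving_neg_ballLaw n ε).integral_comp' (fun h => inner ℝ ν h)
  change ∫ h, inner ℝ ν (-h) ∂(ballLaw n ε) = _ at h
  simp only [inner_neg_right, integral_neg] at h
  linarith

/-- Pair y with its reflection 2x - y, which lies in the same ball: the affine bounds at the two
points add up to twice the bound at x. -/
theorem ballSup_add_ballInf_le_of_affine {n : ℕ} {v : Space n → ℝ} {B : ℝ}
    (hB : ∀ x, |v x| ≤ B) {ν : Space n} {b : ℝ} {x : Space n} {s : ℝ}
    (hs : 0 < s) (h : ∀ y ∈ ball x s, v y ≤ inner ℝ ν y + b) :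
    ballSup v x s + ballInf v x s ≤ 2 * (inner ℝ ν x + b) := by
  have : ballSup v x s ≤ 2 * (inner ℝ ν x + b) - ballInf v x s := by
    refine ballSup_le hs fun y hy => ?_
    have hy' : x + (x - y) ∈ ball x s := by
      rw [mem_ball, dist_eq_norm] at hy ⊢
      rwa [add_sub_cancel_left, norm_sub_rev]
    have h1 := h y hy
    have h2 := h _ hy'
    have h3 := ballInf_le hB hy'
    rw [inner_add_right, inner_sub_right] at h2
    linarith
  linarith

theorem dpp_le_of_affine {n : ℕ} {p ε : ℝ} (hp : 2 < p) (hε : 0 < ε) {v : Space n → ℝ}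
    (hv : Measurable v) {B : ℝ} (hB : ∀ x, |v x| ≤ B) {ν : Space n} {b : ℝ} {x : Space n}
    (h : ∀ y ∈ ball x ε, v y ≤ inner ℝ ν y + b) :
    dpp p ε v x ≤ inner ℝ ν x + b := by
  have := isProbabilityMeasure_ballLaw (n := n) hε
  have h1 := dpp_le hp hε hv hB (x := x) (ψ := fun h => inner ℝ ν (x + h) + b)
    (integrable_ballLaw_of_continuous hε (by fun_prop)) (c := inner ℝ ν x + b)
    (fun y hy => h _ (by simpa using hy))
    (fun s hs hsε => ballSup_add_ballInf_le_of_affine hB hs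
      fun y hy => h y (ball_subset_ball hsε hy))
  have h2 : ∫ h, (inner ℝ ν (x + h) + b) ∂(ballLaw n ε) = inner ℝ ν x + b := by
    have hi : Integrable (fun h => inner ℝ ν h) (ballLaw n ε) :=
      integrable_ballLaw_of_continuous hε (by fun_prop)
    simp only [inner_add_right, add_right_comm _ _ b]
    rw [integral_add (integrable_const _) hi, integral_inner_ballLaw]
    simp
  rw [h2] at h1
  refine h1.trans (le_of_eq ?_)
  rw [← add_mul, add_comm, alpha_add_beta hp, one_mul]

theorem abs_dpp_sub_affine_le {n : ℕ} {p ε : ℝ} (hp : 2 < p) (hε : 0 < ε) {v : Space n → ℝ}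
    (hv : Measurable v) {B : ℝ} (hB : ∀ x, |v x| ≤ B) {ν : Space n} {b δ : ℝ} {x : Space n}
    (h : ∀ y ∈ ball x ε, |v y - inner ℝ ν y - b| ≤ δ) :
    |dpp p ε v x - inner ℝ ν x - b| ≤ δ := by
  have h1 := dpp_le_of_affine hp hε hv hB (ν := ν) (b := b + δ) (x := x)
    fun y hy => by linarith [(abs_le.1 (h y hy)).2]
  have h2 := dpp_le_of_affine hp hε hv.neg (B := B) (by simpa using hB) (ν := -ν) (b := -b + δ)
    (x := x) fun y hy => by
      rw [inner_neg_left, Pi.neg_apply]; linarith [(abs_le.1 (h y hy)).1]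
  have h3 := dpp_neg p ε v x
  rw [inner_neg_left] at h2
  change dpp p ε (fun y => -v y) x ≤ _ at h2
  rw [abs_le]
  constructor <;> linarith

/-! ### Solving the dynamic programming principle by iteration. -/

/-- Used twice: with the barrier it makes `dpp` a contraction in a weighted norm, and with φ = E = 1
it says that `dpp` is nonexpansive in the sup norm. -/
theorem abs_dpp_sub_le_mul_barrier {n : ℕ} {p ε : ℝ} (hp : 2 < p) (hε : 0 < ε)
    {v w : Space n → ℝ} (hv : Measurable v) (hw : Measurable w) {B : ℝ} (hvB : ∀ x, |v x| ≤ B)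
    (hwB : ∀ x, |w x| ≤ B) {x : Space n} {φ : Space n → ℝ} (hφ : Continuous φ) {c E : ℝ}
    (hc : 0 ≤ c) (hE : ∀ y ∈ ball x ε, φ y ≤ E) (h : ∀ y ∈ ball x ε, |v y - w y| ≤ c * φ y) :
    |dpp p ε v x - dpp p ε w x| ≤
      c * (beta n p * ∫ h, φ (x + h) ∂(ballLaw n ε) + alpha n p * E) := by
  have hi : Integrable (fun h => c * φ (x + h)) (ballLaw n ε) :=
    integrable_ballLaw_of_continuous hε (by fun_prop)
  have key : ∀ v w : Space n → ℝ, Measurable v → Measurable w → (∀ x, |v x| ≤ B) →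
      (∀ x, |w x| ≤ B) → (∀ y ∈ ball x ε, |v y - w y| ≤ c * φ y) →
      dpp p ε v x - dpp p ε w x ≤
        c * (beta n p * ∫ h, φ (x + h) ∂(ballLaw n ε) + alpha n p * E) := by
    intro v w hv hw hvB hwB h
    have := dpp_sub_le hp hε hv hw hvB hwB hi (c := c * E)
      (fun y hy => (le_abs_self _).trans (h _ (by simpa using hy)))
      (fun y hy => ((le_abs_self _).trans (h _ hy)).trans
        (mul_le_mul_of_nonneg_left (hE y hy) hc))
    rw [integral_const_mul] at this
    linarith
  have h1 := key v w hv hw hvB hwB h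
  have h2 := key w v hw hv hwB hvB fun y hy => by rw [abs_sub_comm]; exact h y hy
  exact abs_le.2 ⟨by linarith, h1⟩

/-- Existence of a solution of the dynamic programming principle with prescribed exterior data; it
is as close to an affine function as its exterior data are. -/
theorem exists_dpp_solution {n : ℕ} (hn : 2 ≤ n) {p ε : ℝ} (hp : 2 < p) (hε : 0 < ε)
    {Ω D : Set (Space n)} (hΩ : MeasurableSet Ω) {R : ℝ} (hR : ∀ x ∈ Ω, ‖x‖ ≤ R)
    (hD : ∀ x ∈ Ω, ball x ε ⊆ D) {Φ : Space n → ℝ} (hΦ : Measurable Φ) {B₀ : ℝ}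
    (hB₀ : ∀ x, |Φ x| ≤ B₀) {ν : Space n} {b δ : ℝ} (hδ : 0 ≤ δ)
    (hL : ∀ x ∈ D, x ∉ Ω → |Φ x - inner ℝ ν x - b| ≤ δ) :
    ∃ (u : Space n → ℝ) (B : ℝ), Measurable u ∧ (∀ x, |u x| ≤ B) ∧ (∀ x ∉ Ω, u x = Φ x) ∧
      (∀ x ∈ Ω, u x = dpp p ε u x) ∧ ∀ x ∈ D, |u x - inner ℝ ν x - b| ≤ δ := by
  classical
  obtain ⟨φ, E, κ, hφc, hκ0, hκ1, hφ, hφκ⟩ := exists_barrier hn hp hε R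
  let L : Space n → ℝ := fun x => inner ℝ ν x + b
  have hLm : Measurable L := by fun_prop
  let step : (Space n → ℝ) → Space n → ℝ := fun v => Ω.piecewise (dpp p ε v) Φ
  let v : ℕ → Space n → ℝ := fun k => step^[k] (Ω.piecewise L Φ)
  have hv_succ : ∀ k, v (k + 1) = Ω.piecewise (dpp p ε (v k)) Φ := fun k =>
    Function.iterate_succ_apply' step k _
  have hv_out : ∀ k x, x ∉ Ω → v k x = Φ x := by
    intro k x hx
    rcases k with - | k
    · exact Set.piecewise_eq_of_notMem _ _ _ hx
    · rw [hv_succ]; exact Set.piecewise_eq_of_notMem _ _ _ hx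
  have hv_in : ∀ k x, x ∈ Ω → v (k + 1) x = dpp p ε (v k) x := by
    intro k x hx
    rw [hv_succ]; exact Set.piecewise_eq_of_mem _ _ _ hx
  set B := max B₀ (‖ν‖ * R + |b|) with hBdef
  have hB0 : 0 ≤ B := (abs_nonneg _).trans ((hB₀ 0).trans (le_max_left _ _))
  have hv : ∀ k, Measurable (v k) ∧ (∀ x, |v k x| ≤ B) := by
    intro k
    induction k with
    | zero =>
      refine ⟨Measurable.piecewise hΩ hLm hΦ, fun x => ?_⟩
      by_cases hx : x ∈ Ω
      · have : v 0 x = L x := Set.piecewise_eq_of_mem _ _ _ hx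
        rw [this]
        refine le_trans ?_ (le_max_right _ _)
        calc |L x| ≤ |inner ℝ ν x| + |b| := abs_add_le _ _
          _ ≤ ‖ν‖ * ‖x‖ + |b| := by gcongr; exact abs_real_inner_le_norm ν x
          _ ≤ _ := by gcongr; exact hR x hx
      · rw [hv_out 0 x hx]; exact (hB₀ x).trans (le_max_left _ _)
    | succ k ih =>
      refine ⟨?_, fun x => ?_⟩
      · rw [hv_succ]; exact Measurable.piecewise hΩ (measurable_dpp hε ih.1 ih.2) hΦ
      · by_cases hx : x ∈ Ω
        · rw [hv_in k x hx]; exact abs_dpp_le hp hε ih.1 ih.2 x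
        · rw [hv_out _ x hx]; exact (hB₀ x).trans (le_max_left _ _)
  have hvL : ∀ k, ∀ x ∈ D, |v k x - inner ℝ ν x - b| ≤ δ := by
    intro k
    induction k with
    | zero =>
      intro x hxD
      by_cases hx : x ∈ Ω
      · have : v 0 x = L x := Set.piecewise_eq_of_mem _ _ _ hx
        rw [this]
        have : L x - inner ℝ ν x - b = 0 := by simp only [L]; ring
        rwa [this, abs_zero]
      · rw [hv_out 0 x hx]; exact hL x hxD hx
    | succ k ih =>
      intro x hxD
      by_cases hx : x ∈ Ω
      · rw [hv_in k x hx]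
        exact abs_dpp_sub_affine_le hp hε (hv k).1 (hv k).2 fun y hy => ih y (hD x hx hy)
      · rw [hv_out _ x hx]; exact hL x hxD hx
  have hball : ∀ x ∈ Ω, ∀ y ∈ ball x ε, ‖y‖ ≤ R + ε := by
    intro x hx y hy
    rw [mem_ball, dist_eq_norm] at hy
    have := norm_le_norm_add_norm_sub' y x
    linarith [hR x hx]
  -- All iterates agree outside Ω, so the weighted bound is free there; inside, the barrier supplies
  -- one factor κ per iteration.
  have hdiff : ∀ k, ∀ x ∈ Ω, |v (k + 1) x - v k x| ≤ 2 * B * κ ^ k * φ x := by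
    intro k
    induction k with
    | zero =>
      intro x hx
      have h1 := (hφ x (by linarith [hR x hx])).1
      have h2 := abs_sub (v 1 x) (v 0 x)
      have h3 := (hv 1).2 x
      have h4 := (hv 0).2 x
      rw [pow_zero, mul_one, zero_add]
      nlinarith
    | succ k ih =>
      intro x hx
      rw [hv_in _ x hx, hv_in _ x hx]
      have hc : 0 ≤ 2 * B * κ ^ k := by positivity
      refine (abs_dpp_sub_le_mul_barrier hp hε (hv _).1 (hv _).1 (hv _).2 (hv _).2 hφc
        (c := 2 * B * κ ^ k) (E := E) hc (fun y hy => (hφ y (hball x hx y hy)).2) ?_).trans ?_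
      · intro y hy
        by_cases hy' : y ∈ Ω
        · exact ih y hy'
        · rw [hv_out _ y hy', hv_out _ y hy', sub_self, abs_zero]
          have := (hφ y (hball x hx y hy)).1
          positivity
      · calc _ ≤ 2 * B * κ ^ k * (κ * φ x) :=
            mul_le_mul_of_nonneg_left (hφκ x (hR x hx)) hc
          _ = _ := by ring
  have hdist : ∀ x k, dist (v k x) (v (k + 1) x) ≤ 2 * B * |E| * κ ^ k := by
    intro x k
    rw [dist_comm, Real.dist_eq]
    by_cases hx : x ∈ Ω
    · refine (hdiff k x hx).trans ?_
      have h1 := (hφ x (by linarith [hR x hx])).2.trans (le_abs_self E)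
      calc _ ≤ 2 * B * κ ^ k * |E| := by gcongr
        _ = _ := by ring
    · rw [hv_out _ x hx, hv_out _ x hx, sub_self, abs_zero]
      positivity
  have hlim : ∀ x, ∃ l, Filter.Tendsto (fun k => v k x) Filter.atTop (nhds l) := fun x =>
    cauchySeq_tendsto_of_complete (cauchySeq_of_le_geometric κ _ hκ1 (hdist x))
  choose u hu using hlim
  have hum : Measurable u := measurable_of_tendsto_metrizable (fun k => (hv k).1)
    (tendsto_pi_nhds.2 hu)
  have huB : ∀ x, |u x| ≤ B := fun x =>
    le_of_tendsto (hu x).abs (Filter.Eventually.of_forall fun k => (hv k).2 x)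
  refine ⟨u, B, hum, huB, fun x hx => ?_, fun x hx => ?_, fun x hx => ?_⟩
  · refine tendsto_nhds_unique (hu x) ?_
    simp only [hv_out _ x hx]
    exact tendsto_const_nhds
  · have h1 : Filter.Tendsto (fun k => v (k + 1) x) Filter.atTop (nhds (u x)) :=
      (hu x).comp (Filter.tendsto_add_atTop_nat 1)
    refine tendsto_nhds_unique h1 ?_
    rw [tendsto_iff_dist_tendsto_zero]
    have := isProbabilityMeasure_ballLaw (n := n) hε
    -- Pointwise limits need not commute with suprema over balls. The geometric rate is uniform in
    -- x, and nonexpansiveness in the sup norm then passes to the limit.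
    have h2 : ∀ k, dist (v (k + 1) x) (dpp p ε u x) ≤ 2 * B * |E| * κ ^ k / (1 - κ) := by
      intro k
      rw [hv_in k x hx, Real.dist_eq]
      have hnn : 0 ≤ 2 * B * |E| * κ ^ k / (1 - κ) := by
        have : 0 < 1 - κ := by linarith
        positivity
      refine (abs_dpp_sub_le_mul_barrier hp hε (hv _).1 hum (hv _).2 huB (φ := fun _ => 1)
        continuous_const (E := 1) hnn (fun _ _ => le_rfl) fun y _ => ?_).trans (le_of_eq ?_)
      · rw [mul_one, ← Real.dist_eq]
        exact dist_le_of_le_geometric_of_tendsto κ _ hκ1 (hdist y) (hu y) k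
      · simp only [integral_const, probReal_univ, smul_eq_mul, mul_one]
        rw [add_comm, alpha_add_beta hp, mul_one]
    refine squeeze_zero (fun _ => dist_nonneg) h2 ?_
    have h3 := ((tendsto_pow_atTop_nhds_zero_of_lt_one hκ0.le hκ1).const_mul
      (2 * B * |E|)).div_const (1 - κ)
    simpa using h3
  · exact le_of_tendsto (((hu x).sub_const _).sub_const _).abs
      (Filter.Eventually.of_forall fun k => hvL k x hx)


/-! ### One-step inequalities along the game, and almost sure exit. -/

/-- The conditional expectation of `f(x_{k+1})` given the history up to step `k`. -/
noncomputable def stepMean {n : ℕ} (p ε : ℝ) (S₁ S₂ : Strategy n) (f : Space n → ℝ) (k : ℕ)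
    (h : History n k) : ℝ :=
  beta n p * ∫ y, f (lastPos h + y) ∂(ballLaw n ε) +
    alpha n p / 2 * ∫ s, f (S₁.move k h s) ∂(stepLaw ε) +
    alpha n p / 2 * ∫ s, f (S₂.move k h s) ∂(stepLaw ε)

theorem measurable_move {n : ℕ} (S : Strategy n) (k : ℕ) (h : History n k) :
    Measurable (S.move k h) :=
  Measurable.of_uncurry_left (f := S.move k) (S.measurable_move k)

theorem integral_nextRound {n : ℕ} {p ε : ℝ} (hp : 2 < p) (hε : 0 < ε) (S₁ S₂ : Strategy n)
    {f : Space n → ℝ} (hf : Measurable f) {B : ℝ} (hB : ∀ x, |f x| ≤ B) (k : ℕ)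
    (h : History n k) :
    ∫ w, f (nextRound S₁ S₂ k h w).2.2 ∂(noiseLaw n p ε) = stepMean p ε S₁ S₂ f k h := by
  have := integral_noiseLaw (n := n) hp hε (f := fun y => f (lastPos h + y))
    (g₁ := fun s => f (S₁.move k h s)) (g₂ := fun s => f (S₂.move k h s)) (by fun_prop)
    (hf.comp (measurable_move S₁ k h)) (hf.comp (measurable_move S₂ k h)) (fun _ => hB _)
    (fun _ => hB _) (fun _ => hB _)
  rw [stepMean, ← this]
  congr 1 with w
  simp only [nextRound]
  split_ifs <;> rfl

/-- The trajectories that stay in `Ω` up to time `k`. -/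
def aliveSet {n : ℕ} (Ω : Set (Space n)) (k : ℕ) : Set (ℕ → Round n) :=
  {ω | ∀ i ≤ k, pos i ω ∈ Ω}

/-- The histories that stay in `Ω`. -/
def aliveHistory {n : ℕ} (Ω : Set (Space n)) (k : ℕ) : Set (History n k) :=
  {h | ∀ i, (h i).2.2 ∈ Ω}

theorem frestrictLe_mem_aliveHistory {n : ℕ} {Ω : Set (Space n)} {k : ℕ} {ω : ℕ → Round n} :
    (Preorder.frestrictLe k ω : History n k) ∈ aliveHistory Ω k ↔ ω ∈ aliveSet Ω k :=
  ⟨fun h i hi => h ⟨i, Finset.mem_Iic.2 hi⟩, fun h i => h i.1 (Finset.mem_Iic.1 i.2)⟩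

theorem measurableSet_aliveSet {n : ℕ} {Ω : Set (Space n)} (hΩ : MeasurableSet Ω) (k : ℕ) :
    MeasurableSet (aliveSet Ω k) := by
  have : aliveSet Ω k = ⋂ i ∈ Set.Iic k, (pos i : (ℕ → Round n) → Space n) ⁻¹' Ω := by
    ext ω; simp [aliveSet]
  rw [this]
  exact MeasurableSet.biInter (Set.to_countable _) fun i _ => measurable_pos i hΩ

theorem measurableSet_aliveHistory {n : ℕ} {Ω : Set (Space n)} (hΩ : MeasurableSet Ω) (k : ℕ) :
    MeasurableSet (aliveHistory Ω k) := by
  have : aliveHistory Ω k = ⋂ i, (fun h : History n k => (h i).2.2) ⁻¹' Ω := by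
    ext h; simp [aliveHistory]
  rw [this]
  exact MeasurableSet.iInter fun i => (measurable_pi_apply i).snd.snd hΩ

theorem mem_aliveSet_succ {n : ℕ} {Ω : Set (Space n)} {k : ℕ} {ω : ℕ → Round n} :
    ω ∈ aliveSet Ω (k + 1) ↔ ω ∈ aliveSet Ω k ∧ pos (k + 1) ω ∈ Ω := by
  constructor
  · exact fun h => ⟨fun i hi => h i (by omega), h _ le_rfl⟩
  · rintro ⟨h1, h2⟩ i hi
    rcases Nat.lt_or_ge k i with h | h
    · obtain rfl : i = k + 1 := by omega
      exact h2
    · exact h1 i h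

/-- Integration of a one-step inequality over the trajectories that are still in `Ω`. -/
theorem integral_alive_le {n : ℕ} {p ε : ℝ} (hp : 2 < p) (hε : 0 < ε) {S₁ S₂ : Strategy n}
    (x₀ : Space n) {Ω : Set (Space n)} (hΩ : MeasurableSet Ω) (k : ℕ) {f g : Space n → ℝ}
    (hf : Measurable f) {B : ℝ} (hB : ∀ x, |f x| ≤ B) (hg : Measurable g) {B' : ℝ}
    (hB' : ∀ x, |g x| ≤ B')
    (h : ∀ h ∈ aliveHistory Ω k, stepMean p ε S₁ S₂ f k h ≤ g (lastPos h)) :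
    ∫ ω, (aliveSet Ω k).indicator (fun ω => f (pos (k + 1) ω)) ω ∂(gameMeasure hp hε S₁ S₂ x₀) ≤
      ∫ ω, (aliveSet Ω k).indicator (fun ω => g (pos k ω)) ω ∂(gameMeasure hp hε S₁ S₂ x₀) := by
  classical
  have := isProbabilityMeasure_gameMeasure hp hε S₁ S₂ x₀
  have := isProbabilityMeasure_noiseLaw (n := n) hp hε
  have hH := measurableSet_aliveHistory hΩ k
  have hB0 : 0 ≤ B := (abs_nonneg _).trans (hB 0)
  -- Staying in Ω up to time k depends on the history only, so its indicator passes through the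
  -- integration over the next round.
  let ψ : History n k × Round n → ℝ :=
    fun q => (aliveHistory Ω k).indicator (fun _ => f q.2.2.2) q.1
  have hψ : Measurable ψ := by
    have : ψ = (Prod.fst ⁻¹' aliveHistory Ω k).indicator (fun q => f q.2.2.2) := by
      ext q; simp [ψ, Set.indicator]
    rw [this]
    exact (hf.comp measurable_snd.snd.snd).indicator (measurable_fst hH)
  have hψB : ∀ q, |ψ q| ≤ B := fun q => by
    by_cases hq : q.1 ∈ aliveHistory Ω k
    · simpa [ψ, hq] using hB _
    · simpa [ψ, hq] using hB0
  have hin : ∀ h : History n k, ∫ w, ψ (h, nextRound S₁ S₂ k h w) ∂(noiseLaw n p ε) =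
      (aliveHistory Ω k).indicator (stepMean p ε S₁ S₂ f k) h := by
    intro h
    by_cases hh : h ∈ aliveHistory Ω k
    · simp only [ψ, hh, Set.indicator_of_mem]
      exact integral_nextRound hp hε S₁ S₂ hf hB k h
    · simp [ψ, hh]
  have h1 := integral_gameMeasure_succ hp hε S₁ S₂ x₀ k hψ hψB
  simp only [hin] at h1
  have h2 : ∀ ω : ℕ → Round n, ψ (Preorder.frestrictLe k ω, ω (k + 1)) =
      (aliveSet Ω k).indicator (fun ω => f (pos (k + 1) ω)) ω := by
    intro ω
    simp only [ψ, Set.indicator, frestrictLe_mem_aliveHistory]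
    rfl
  simp only [h2] at h1
  rw [h1]
  have hm : Measurable fun h : History n k =>
      (aliveHistory Ω k).indicator (stepMean p ε S₁ S₂ f k) h := by
    simp only [← hin]
    have : Measurable fun q : History n k × (Fin 3 × ℝ × Space n) =>
        ψ (q.1, nextRound S₁ S₂ k q.1 q.2) :=
      hψ.comp (measurable_fst.prodMk (measurable_nextRound S₁ S₂ k))
    exact (this.stronglyMeasurable.integral_prod_right' (ν := noiseLaw n p ε)).measurable
  have hmB : ∀ h : History n k, |(aliveHistory Ω k).indicator (stepMean p ε S₁ S₂ f k) h| ≤ B := by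
    intro h
    rw [← hin]
    have := norm_integral_le_of_norm_le_const (μ := noiseLaw n p ε)
      (f := fun w => ψ (h, nextRound S₁ S₂ k h w)) (C := B)
      (ae_of_all _ fun w => hψB (h, nextRound S₁ S₂ k h w))
    simpa using this
  refine integral_mono (integrable_of_bound (hm.comp (Preorder.measurable_frestrictLe k))
    fun ω => hmB _) ((integrable_of_bound (hg.comp (measurable_pos k)) fun ω => hB' _).indicator
    (measurableSet_aliveSet hΩ k)) fun ω => ?_
  by_cases hω : ω ∈ aliveSet Ω k
  · have hω' := frestrictLe_mem_aliveHistory.2 hω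
    simp only [Set.indicator_of_mem hω, Set.indicator_of_mem hω']
    exact h _ hω'
  · have hω' := fun h => hω (frestrictLe_mem_aliveHistory.1 h)
    simp only [Set.indicator_of_notMem hω, Set.indicator_of_notMem hω', le_refl]

theorem lastPos_mem_of_alive {n : ℕ} {Ω : Set (Space n)} {k : ℕ} {h : History n k}
    (hh : h ∈ aliveHistory Ω k) : lastPos h ∈ Ω := hh _

/-- A bound for the mean after one step from bounds for the three kinds of moves. -/
theorem stepMean_le {n : ℕ} {p ε : ℝ} (hp : 2 < p) (hε : 0 < ε) (S₁ S₂ : Strategy n)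
    {f : Space n → ℝ} (hf : Measurable f) {B : ℝ} (hB : ∀ x, |f x| ≤ B) {k : ℕ}
    {h : History n k} {ψ : Space n → ℝ} (hψ : Integrable ψ (ballLaw n ε)) {c : ℝ}
    (h₁ : ∀ y, ‖y‖ < ε → f (lastPos h + y) ≤ ψ y)
    (h₂ : ∀ y ∈ ball (lastPos h) ε, f y ≤ c) :
    stepMean p ε S₁ S₂ f k h ≤ beta n p * ∫ y, ψ y ∂(ballLaw n ε) + alpha n p * c := by
  have := isProbabilityMeasure_stepLaw hε
  have := isProbabilityMeasure_ballLaw (n := n) hε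
  have ha := alpha_pos (n := n) hp
  have hb := beta_pos (n := n) hp
  have e1 : ∫ y, f (lastPos h + y) ∂(ballLaw n ε) ≤ ∫ y, ψ y ∂(ballLaw n ε) := by
    refine integral_mono_ae (integrable_of_bound (B := B) (by fun_prop) fun h => hB _) hψ ?_
    filter_upwards [ae_ballLaw n ε] with y hy using h₁ y hy
  have e2 : ∀ S : Strategy n, ∫ s, f (S.move k h s) ∂(stepLaw ε) ≤ c := by
    intro S
    refine integral_le_of_ae_le_const
      (integrable_of_bound (hf.comp (measurable_move S k h)) fun s => hB _) ?_
    filter_upwards [ae_stepLaw ε] with s hs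
    exact h₂ _ (ball_subset_ball hs.2 (S.move_mem k h s hs.1))
  have e1' := mul_le_mul_of_nonneg_left e1 hb.le
  have e2' := mul_le_mul_of_nonneg_left (e2 S₁) (half_pos ha).le
  have e3' := mul_le_mul_of_nonneg_left (e2 S₂) (half_pos ha).le
  unfold stepMean
  linarith

/-- The players move with equal probability, so only the sum of the two values matters: one player
is nearly optimal, and the other cannot beat the extremum over the ball. -/
theorem stepMean_le_dpp {n : ℕ} {p ε : ℝ} (hp : 2 < p) (hε : 0 < ε) (S₁ S₂ : Strategy n)
    {f : Space n → ℝ} (hf : Measurable f) {B : ℝ} (hB : ∀ x, |f x| ≤ B) {k : ℕ}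
    {h : History n k} {η : ℝ} (hη : 0 ≤ η)
    (h₁ : ∀ s, 0 < s → f (S₁.move k h s) + f (S₂.move k h s) ≤
      ballSup f (lastPos h) s + ballInf f (lastPos h) s + η) :
    stepMean p ε S₁ S₂ f k h ≤ dpp p ε f (lastPos h) + η := by
  have := isProbabilityMeasure_stepLaw hε
  have ha := alpha_pos (n := n) hp
  have hb := beta_pos (n := n) hp
  have hab := alpha_add_beta (n := n) hp
  have hi : ∀ S : Strategy n, Integrable (fun s => f (S.move k h s)) (stepLaw ε) := fun S =>
    integrable_of_bound (hf.comp (measurable_move S k h)) fun s => hB _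
  have hi' := integrable_ballSup_add_ballInf hε hB (lastPos h)
  have e : ∫ s, f (S₁.move k h s) ∂(stepLaw ε) + ∫ s, f (S₂.move k h s) ∂(stepLaw ε) ≤
      ∫ s, (ballSup f (lastPos h) s + ballInf f (lastPos h) s) ∂(stepLaw ε) + η := by
    rw [← integral_add (hi S₁) (hi S₂)]
    have : ∫ s, (f (S₁.move k h s) + f (S₂.move k h s)) ∂(stepLaw ε) ≤
        ∫ s, ((ballSup f (lastPos h) s + ballInf f (lastPos h) s) + η) ∂(stepLaw ε) := by
      refine integral_mono_ae ((hi S₁).add (hi S₂)) (hi'.add (integrable_const η)) ?_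
      filter_upwards [ae_stepLaw ε] with s hs using h₁ s hs.1
    rw [integral_add hi' (integrable_const η)] at this
    simpa using this
  have e' := mul_le_mul_of_nonneg_left e (half_pos ha).le
  have : alpha n p / 2 * η ≤ η := by nlinarith
  unfold stepMean dpp
  linarith

/-- Moves are shorter than ε outside a null set of noise, so the indicator of the complement of D
has mean zero after one step from Ω. -/
theorem ae_pos_succ_mem {n : ℕ} {p ε : ℝ} (hp : 2 < p) (hε : 0 < ε) (S₁ S₂ : Strategy n)
    (x₀ : Space n) {Ω D : Set (Space n)} (hΩ : MeasurableSet Ω) (hDm : MeasurableSet D)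
    (hD : ∀ x ∈ Ω, ball x ε ⊆ D) (k : ℕ) :
    ∀ᵐ ω ∂(gameMeasure hp hε S₁ S₂ x₀), ω ∈ aliveSet Ω k → pos (k + 1) ω ∈ D := by
  classical
  have := isProbabilityMeasure_gameMeasure hp hε S₁ S₂ x₀
  let f : Space n → ℝ := Dᶜ.indicator 1
  have hf : Measurable f := measurable_one.indicator hDm.compl
  have hf0 : ∀ x, 0 ≤ f x := fun x => Set.indicator_nonneg (fun _ _ => zero_le_one) x
  have hB : ∀ x, |f x| ≤ 1 := fun x => by
    rw [abs_of_nonneg (hf0 x)]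
    exact Set.indicator_le' (fun _ _ => le_rfl) (fun _ _ => zero_le_one) x
  have hfD : ∀ y ∈ D, f y ≤ 0 := fun y hy => by simp [f, hy]
  have h := integral_alive_le hp hε (S₁ := S₁) (S₂ := S₂) x₀ hΩ k hf hB (g := fun _ => 0)
    measurable_const (B' := 0) (by simp) fun h hh => by
      have hx := hD _ (lastPos_mem_of_alive hh)
      have := stepMean_le hp hε S₁ S₂ hf hB (ψ := fun _ => 0) (integrable_zero _ _ _) (c := 0)
        (h := h) (fun y hy => hfD _ (hx (by simpa using hy))) (fun y hy => hfD y (hx hy))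
      simpa using this
  have hnn : ∀ ω, 0 ≤ (aliveSet Ω k).indicator (fun ω => f (pos (k + 1) ω)) ω := fun ω =>
    Set.indicator_nonneg (fun _ _ => hf0 _) ω
  have hz : ∫ ω, (aliveSet Ω k).indicator (fun ω => f (pos (k + 1) ω)) ω
      ∂(gameMeasure hp hε S₁ S₂ x₀) = 0 :=
    le_antisymm (by simpa using h) (integral_nonneg hnn)
  rw [integral_eq_zero_iff_of_nonneg hnn ((integrable_of_bound (hf.comp (measurable_pos (k + 1)))
    fun ω => hB _).indicator (measurableSet_aliveSet hΩ k))] at hz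
  filter_upwards [hz] with ω hω hω'
  by_contra hc
  rw [Set.indicator_of_mem hω'] at hω
  simp [f, hc] at hω

/-- The game leaves a bounded set almost surely. -/
theorem ae_exists_exit {n : ℕ} (hn : 2 ≤ n) {p ε : ℝ} (hp : 2 < p) (hε : 0 < ε)
    (S₁ S₂ : Strategy n) (x₀ : Space n) {Ω : Set (Space n)} (hΩ : MeasurableSet Ω) {R : ℝ}
    (hR : ∀ x ∈ Ω, ‖x‖ ≤ R) :
    ∀ᵐ ω ∂(gameMeasure hp hε S₁ S₂ x₀), ∃ k, pos k ω ∉ Ω := by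
  classical
  have := isProbabilityMeasure_gameMeasure hp hε S₁ S₂ x₀
  obtain ⟨φ, E, κ, hφc, hκ0, hκ1, hφ, hφκ⟩ := exists_barrier hn hp hε R
  set G := gameMeasure hp hε S₁ S₂ x₀ with hG
  rcases Set.eq_empty_or_nonempty Ω with rfl | ⟨x₁, hx₁⟩
  · exact ae_of_all _ fun ω => ⟨0, by simp⟩
  have hE1 : 1 ≤ E := by
    have := hφ x₁ (by linarith [hR x₁ hx₁])
    linarith
  have hφΩ : ∀ x ∈ Ω, 1 ≤ φ x ∧ φ x ≤ E := fun x hx => hφ x (by linarith [hR x hx])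
  -- Cutting φ off outside Ω builds survival of the next round into f, so `q` closes up under one
  -- step.
  let f : Space n → ℝ := Ω.indicator φ
  have hf : Measurable f := hφc.measurable.indicator hΩ
  have hf0 : ∀ x, 0 ≤ f x := fun x =>
    Set.indicator_nonneg (fun x hx => by linarith [(hφΩ x hx).1]) x
  have hfE : ∀ x, f x ≤ E := fun x =>
    Set.indicator_apply_le' (fun hx => (hφΩ x hx).2) (fun _ => by linarith)
  have hB : ∀ x, |f x| ≤ E := fun x => by rw [abs_of_nonneg (hf0 x)]; exact hfE x
  let q : ℕ → ℝ := fun k => ∫ ω, (aliveSet Ω k).indicator (fun ω => f (pos k ω)) ω ∂G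
  have hint : ∀ k, Integrable ((aliveSet Ω k).indicator (fun ω => f (pos k ω))) G := fun k =>
    (integrable_of_bound (hf.comp (measurable_pos k)) fun ω => hB _).indicator
      (measurableSet_aliveSet hΩ k)
  have hq : ∀ k, q (k + 1) ≤ κ * q k := by
    intro k
    have h := integral_alive_le hp hε (S₁ := S₁) (S₂ := S₂) x₀ hΩ k hf hB
      (g := fun x => κ * f x) (by fun_prop) (B' := κ * E)
      (fun x => by rw [abs_mul, abs_of_pos hκ0]; exact mul_le_mul_of_nonneg_left (hB x) hκ0.le)
      fun h hh => by
        have hx := lastPos_mem_of_alive hh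
        have := stepMean_le hp hε S₁ S₂ hf hB (ψ := fun y => φ (lastPos h + y))
          (integrable_ballLaw_of_continuous hε (by fun_prop)) (c := E) (h := h)
          (fun y hy => Set.indicator_apply_le' (fun _ => le_rfl) fun _ => by
            have := (hφ (lastPos h + y) ((norm_add_le _ _).trans
              (by linarith [hR _ hx]))).1
            linarith) (fun y _ => hfE y)
        refine this.trans ((hφκ _ (hR _ hx)).trans (le_of_eq ?_))
        simp [f, hx]
    have e1 : ∀ ω, (aliveSet Ω (k + 1)).indicator (fun ω => f (pos (k + 1) ω)) ω =
        (aliveSet Ω k).indicator (fun ω => f (pos (k + 1) ω)) ω := by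
      intro ω
      by_cases h1 : ω ∈ aliveSet Ω k
      · by_cases h2 : pos (k + 1) ω ∈ Ω
        · rw [Set.indicator_of_mem h1, Set.indicator_of_mem (mem_aliveSet_succ.2 ⟨h1, h2⟩)]
        · rw [Set.indicator_of_mem h1,
            Set.indicator_of_notMem fun h => h2 (mem_aliveSet_succ.1 h).2]
          simp [f, h2]
      · rw [Set.indicator_of_notMem h1,
          Set.indicator_of_notMem fun h => h1 (mem_aliveSet_succ.1 h).1]
    have e2 : ∀ ω, (aliveSet Ω k).indicator (fun ω => κ * f (pos k ω)) ω =
        κ * (aliveSet Ω k).indicator (fun ω => f (pos k ω)) ω := fun ω => by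
      by_cases h1 : ω ∈ aliveSet Ω k <;> simp [h1]
    simp only [e2, integral_const_mul, ← e1] at h
    exact h
  have hq' : ∀ k, q k ≤ κ ^ k * q 0 := by
    intro k
    induction k with
    | zero => simp
    | succ k ih =>
      calc q (k + 1) ≤ κ * q k := hq k
        _ ≤ κ * (κ ^ k * q 0) := by gcongr
        _ = _ := by ring
  -- φ ≥ 1 on Ω, so `q` dominates the probability of survival.
  have hP : ∀ k, G.real (aliveSet Ω k) ≤ q k := by
    intro k
    have hm := measurableSet_aliveSet hΩ k
    rw [← integral_indicator_one hm]
    refine integral_mono ((integrable_const (1 : ℝ)).indicator hm) (hint k) fun ω => ?_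
    by_cases h1 : ω ∈ aliveSet Ω k
    · have hx : pos k ω ∈ Ω := h1 k le_rfl
      simpa [h1, f, hx] using (hφΩ _ hx).1
    · simp [h1]
  have hzero : G.real (⋂ k, aliveSet Ω k) ≤ 0 := by
    have ht := (tendsto_pow_atTop_nhds_zero_of_lt_one hκ0.le hκ1).mul_const (q 0)
    rw [zero_mul] at ht
    exact ge_of_tendsto ht (Filter.Eventually.of_forall fun k =>
      (measureReal_mono (Set.iInter_subset _ k)).trans ((hP k).trans (hq' k)))
  have hz : G (⋂ k, aliveSet Ω k) = 0 :=
    (measureReal_eq_zero_iff).1 (le_antisymm hzero measureReal_nonneg)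
  rw [ae_iff]
  refine measure_mono_null (fun ω hω => ?_) hz
  simp only [Set.mem_ofPred_eq, not_exists, not_not] at hω
  exact Set.mem_iInter.2 fun k i _ => hω i

/-! ### The stopped process and the expected payoff. -/

/-- The process `V(x_k)` stopped at the exit from `Ω`. -/
noncomputable def stopped {n : ℕ} (Ω : Set (Space n)) (V : Space n → ℝ) :
    ℕ → (ℕ → Round n) → ℝ
  | 0, ω => V (pos 0 ω)
  | k + 1, ω => stopped Ω V k ω +
      (aliveSet Ω k).indicator (fun ω => V (pos (k + 1) ω) - V (pos k ω)) ω

theorem measurable_stopped {n : ℕ} {Ω : Set (Space n)} (hΩ : MeasurableSet Ω)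
    {V : Space n → ℝ} (hV : Measurable V) (k : ℕ) : Measurable (stopped Ω V k) := by
  induction k with
  | zero => exact hV.comp (measurable_pos 0)
  | succ k ih =>
    exact ih.add (((hV.comp (measurable_pos (k + 1))).sub (hV.comp (measurable_pos k))).indicator
      (measurableSet_aliveSet hΩ k))

theorem stopped_eq {n : ℕ} {Ω : Set (Space n)} (V : Space n → ℝ) {ω : ℕ → Round n} {N : ℕ}
    (hN : pos N ω ∉ Ω) (hlt : ∀ i < N, pos i ω ∈ Ω) (k : ℕ) :
    stopped Ω V k ω = V (pos (min k N) ω) := by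
  induction k with
  | zero => simp [stopped]
  | succ k ih =>
    rw [stopped, ih]
    rcases Nat.lt_or_ge k N with h | h
    · have hk : ω ∈ aliveSet Ω k := fun i hi => hlt i (by omega)
      rw [Set.indicator_of_mem hk, min_eq_left h.le, min_eq_left h]
      ring
    · have hk : ω ∉ aliveSet Ω k := fun h' => hN (h' N h)
      rw [Set.indicator_of_notMem hk, min_eq_right h, min_eq_right (by omega), add_zero]

theorem payoff_eq {n : ℕ} {Ω : Set (Space n)} {ε : ℝ} (F : Space n → ℝ) {ω : ℕ → Round n} {N : ℕ}
    (hN : pos N ω ∈ strip Ω ε) (hlt : ∀ i < N, pos i ω ∈ Ω) :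
    payoff Ω ε F ω = F (pos N ω) := by
  classical
  have h : ∃ k, (ω k).2.2 ∈ strip Ω ε := ⟨N, hN⟩
  have : Nat.find h = N := by
    rw [Nat.find_eq_iff]
    exact ⟨hN, fun i hi hc => hc.1 (hlt i hi)⟩
  rw [payoff, dif_pos h]
  conv_rhs => rw [← this]
  rfl

theorem measurableSet_strip {n : ℕ} {Ω : Set (Space n)} (hΩ : MeasurableSet Ω) (ε : ℝ) :
    MeasurableSet (strip Ω ε) :=
  hΩ.compl.inter (isClosed_le (continuous_infDist_pt _) continuous_const).measurableSet

/-- The distance from y ∉ Ω to Ω is attained at a boundary point, so the distance to the boundary is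
below ε. Hence the token cannot jump over the strip, and leaving Ω is the same as reaching the
strip. -/
theorem ball_subset_union_strip {n : ℕ} {Ω : Set (Space n)} {ε : ℝ} {x : Space n} (hx : x ∈ Ω) :
    ball x ε ⊆ Ω ∪ strip Ω ε := by
  intro y hy
  by_cases hyΩ : y ∈ Ω
  · exact Or.inl hyΩ
  · refine Or.inr ⟨hyΩ, ?_⟩
    have hne : Ωᶜ ≠ Set.univ := fun h => by
      have : x ∈ Ωᶜ := h ▸ Set.mem_univ x
      exact this hx
    obtain ⟨z, hz, hyz⟩ := exists_mem_frontier_infDist_compl_eq_dist (x := y) (s := Ωᶜ) hyΩ hne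
    rw [compl_compl] at hyz
    rw [frontier_compl] at hz
    have h1 := infDist_le_dist_of_mem (x := y) hz
    have h2 := infDist_le_dist_of_mem (x := y) hx
    rw [mem_ball] at hy
    linarith

/-- The expected payoff is bounded by a supersolution along the game. -/
theorem integral_payoff_le {n : ℕ} (hn : 2 ≤ n) {p ε : ℝ} (hp : 2 < p) (hε : 0 < ε)
    (S₁ S₂ : Strategy n) {x₀ : Space n} {Ω : Set (Space n)} (hΩ : MeasurableSet Ω) {R : ℝ}
    (hR : ∀ x ∈ Ω, ‖x‖ ≤ R) (hx₀ : x₀ ∈ Ω ∪ strip Ω ε) {V : Space n → ℝ} (hV : Measurable V)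
    {B : ℝ} (hB : ∀ x, |V x| ≤ B) {η : ℕ → ℝ} (hη : ∀ k, 0 ≤ η k)
    {c : ℝ} (hc : ∀ k, ∑ i ∈ Finset.range k, η i ≤ c)
    (h : ∀ k, ∀ h ∈ aliveHistory Ω k, stepMean p ε S₁ S₂ V k h ≤ V (lastPos h) + η k) :
    ∫ ω, payoff Ω ε V ω ∂(gameMeasure hp hε S₁ S₂ x₀) ≤ V x₀ + c := by
  have := isProbabilityMeasure_gameMeasure hp hε S₁ S₂ x₀
  set G := gameMeasure hp hε S₁ S₂ x₀ with hG
  have h0 := pos_zero_ae hp hε S₁ S₂ x₀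
  have hDm : MeasurableSet (Ω ∪ strip Ω ε) := hΩ.union (measurableSet_strip hΩ ε)
  have hexit : ∀ᵐ ω ∂G, ∃ N, pos N ω ∈ strip Ω ε ∧ ∀ i < N, pos i ω ∈ Ω := by
    have hmem := ae_all_iff.2 fun k =>
      ae_pos_succ_mem hp hε S₁ S₂ x₀ hΩ hDm (fun x hx => ball_subset_union_strip hx) k
    filter_upwards [h0, hmem, ae_exists_exit hn hp hε S₁ S₂ x₀ hΩ hR] with ω h0 hmem hex
    classical
    refine ⟨Nat.find hex, ?_, fun i hi => not_not.1 (Nat.find_min hex hi)⟩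
    have hN := Nat.find_spec hex
    have hmin : ∀ i < Nat.find hex, pos i ω ∈ Ω := fun i hi => not_not.1 (Nat.find_min hex hi)
    rcases hNe : Nat.find hex with - | m
    · rw [hNe, h0] at hN
      rw [h0]
      exact hx₀.resolve_left hN
    · rw [hNe] at hN hmin
      exact (hmem m fun i hi => hmin i (by omega)).resolve_left hN
  have hlim : Filter.Tendsto (fun k => ∫ ω, stopped Ω V k ω ∂G) Filter.atTop
      (nhds (∫ ω, payoff Ω ε V ω ∂G)) := by
    refine tendsto_integral_of_dominated_convergence (fun _ => B)
      (fun k => (measurable_stopped hΩ hV k).aestronglyMeasurable) (integrable_const _)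
      (fun k => ?_) ?_
    · filter_upwards [hexit] with ω ⟨N, hN, hlt⟩
      rw [stopped_eq V hN.1 hlt]
      exact hB _
    · filter_upwards [hexit] with ω ⟨N, hN, hlt⟩
      rw [payoff_eq V hN hlt]
      refine tendsto_const_nhds.congr' ?_
      filter_upwards [Filter.eventually_ge_atTop N] with k hk
      rw [stopped_eq V hN.1 hlt, min_eq_right hk]
  have hVp : ∀ k, Integrable (fun ω => V (pos k ω)) G := fun k =>
    integrable_of_bound (hV.comp (measurable_pos k)) fun ω => hB _
  have hsi : ∀ k, Integrable (stopped Ω V k) G := by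
    intro k
    induction k with
    | zero => exact hVp 0
    | succ k ih =>
      exact ih.add (((hVp (k + 1)).sub (hVp k)).indicator (measurableSet_aliveSet hΩ k))
  have hstep : ∀ k, ∫ ω, stopped Ω V (k + 1) ω ∂G ≤ ∫ ω, stopped Ω V k ω ∂G + η k := by
    intro k
    have hA := measurableSet_aliveSet hΩ k
    have h1 := integral_alive_le hp hε (S₁ := S₁) (S₂ := S₂) x₀ hΩ k hV hB
      (g := fun x => V x + η k) (by fun_prop) (B' := B + η k)
      (fun x => (abs_add_le _ _).trans (by rw [abs_of_nonneg (hη k)]; linarith [hB x])) (h k)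
    rw [integral_indicator hA, integral_indicator hA,
      integral_add (hVp k).integrableOn (integrable_const _).integrableOn] at h1
    have h2 : ∫ _ in aliveSet Ω k, η k ∂G ≤ η k := by
      rw [setIntegral_const, smul_eq_mul]
      exact mul_le_of_le_one_left (hη k) measureReal_le_one
    have h3 : ∫ ω, stopped Ω V (k + 1) ω ∂G = ∫ ω, stopped Ω V k ω ∂G +
        ∫ ω, (aliveSet Ω k).indicator (fun ω => V (pos (k + 1) ω) - V (pos k ω)) ω ∂G :=
      integral_add (hsi k) (((hVp (k + 1)).sub (hVp k)).indicator hA)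
    rw [h3, integral_indicator hA,
      integral_sub (hVp (k + 1)).integrableOn (hVp k).integrableOn]
    linarith
  have hsum : ∀ k, ∫ ω, stopped Ω V k ω ∂G ≤ V x₀ + ∑ i ∈ Finset.range k, η i := by
    intro k
    induction k with
    | zero =>
      have : ∫ ω, stopped Ω V 0 ω ∂G = V x₀ := by
        have h1 : ∫ ω, stopped Ω V 0 ω ∂G = ∫ _, V x₀ ∂G := by
          refine integral_congr_ae ?_
          filter_upwards [h0] with ω hω
          rw [stopped, hω]
        simpa using h1
      simp [this]
    | succ k ih =>
      rw [Finset.sum_range_succ]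
      linarith [hstep k]
  exact le_of_tendsto hlim (Filter.Eventually.of_forall fun k => (hsum k).trans
    (by linarith [hc k]))

/-! ### Identification of the value. -/

theorem payoff_congr {n : ℕ} {Ω : Set (Space n)} {ε : ℝ} {F V : Space n → ℝ}
    (h : ∀ x ∈ strip Ω ε, F x = V x) : payoff Ω ε F = payoff Ω ε V := by
  classical
  ext ω
  unfold payoff
  split_ifs with hω
  · exact h _ (Nat.find_spec hω)
  · rfl

theorem payoff_neg {n : ℕ} (Ω : Set (Space n)) (ε : ℝ) (V : Space n → ℝ) (ω : ℕ → Round n) :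
    payoff Ω ε (fun x => -V x) ω = -payoff Ω ε V ω := by
  unfold payoff
  split_ifs <;> simp

theorem abs_expectedPayoff_le {n : ℕ} {p ε : ℝ} (hp : 2 < p) (hε : 0 < ε) {Ω : Set (Space n)}
    {V : Space n → ℝ} {B : ℝ} (hB : ∀ x, |V x| ≤ B) (x₀ : Space n) (S₁ S₂ : Strategy n) :
    |expectedPayoff hp hε Ω V x₀ S₁ S₂| ≤ B := by
  have := isProbabilityMeasure_gameMeasure hp hε S₁ S₂ x₀
  have h := norm_integral_le_of_norm_le_const (μ := gameMeasure hp hε S₁ S₂ x₀)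
    (f := payoff Ω ε V) (C := B) (ae_of_all _ fun ω => by
      unfold payoff
      split_ifs
      · exact hB _
      · simpa using (abs_nonneg _).trans (hB 0))
  simpa [expectedPayoff] using h

/-- A bounded solution of the dynamic programming principle is the value of the game. -/
theorem valueI_valueII_eq_of_dpp {n : ℕ} (hn : 2 ≤ n) {p ε : ℝ} (hp : 2 < p) (hε : 0 < ε)
    {Ω : Set (Space n)} (hΩ : MeasurableSet Ω) {R : ℝ} (hR : ∀ x ∈ Ω, ‖x‖ ≤ R)
    {F u : Space n → ℝ} (hu : Measurable u) {B : ℝ} (hB : ∀ x, |u x| ≤ B)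
    (hF : ∀ x ∈ strip Ω ε, F x = u x) (hdpp : ∀ x ∈ Ω, u x = dpp p ε u x) {x : Space n}
    (hx : x ∈ Ω ∪ strip Ω ε) :
    valueI hp hε Ω F x = u x ∧ valueII hp hε Ω F x = u x := by
  have hBn : ∀ x, |-u x| ≤ B := by simpa using hB
  have hexp : ∀ S₁ S₂, expectedPayoff hp hε Ω F x S₁ S₂ = expectedPayoff hp hε Ω u x S₁ S₂ :=
    fun S₁ S₂ => by rw [expectedPayoff, payoff_congr hF, expectedPayoff]
  have hbd : ∀ S₁ S₂, |expectedPayoff hp hε Ω u x S₁ S₂| ≤ B :=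
    abs_expectedPayoff_le hp hε hB x
  -- The round with index k is allowed the error η/2^(k+1), so the total loss is at most η.
  have hsum : ∀ η : ℝ, 0 < η → ∀ k, ∑ i ∈ Finset.range k, η / 2 * (1 / 2) ^ i ≤ η := by
    intro η hη k
    rw [← Finset.mul_sum]
    have h1 : ∑ i ∈ Finset.range k, ((1 : ℝ) / 2) ^ i ≤ ∑' i, ((1 : ℝ) / 2) ^ i :=
      summable_geometric_two.sum_le_tsum _ fun i _ => by positivity
    rw [tsum_geometric_two] at h1
    nlinarith
  -- Player II moves to near-minimizers of u, selected as near-maximizers of -u.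
  have hII : ∀ η : ℝ, 0 < η → ∃ S₂ : Strategy n, ∀ S₁ : Strategy n,
      expectedPayoff hp hε Ω u x S₁ S₂ ≤ u x + η := by
    intro η hη
    choose σ hσm hσ using fun k : ℕ => exists_measurable_selector hBn
      (show 0 < η / 2 * (1 / 2) ^ k by positivity)
    refine ⟨selectorStrategy σ hσm fun k x s hs => (hσ k x s hs).1, fun S₁ => ?_⟩
    refine integral_payoff_le hn hp hε _ _ hΩ hR hx hu hB (fun k => by positivity)
      (hsum η hη) fun k h hh => ?_
    have hxΩ := lastPos_mem_of_alive hh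
    rw [hdpp _ hxΩ]
    refine stepMean_le_dpp hp hε _ _ hu hB (by positivity) fun s hs => ?_
    have h1 := le_ballSup hB (S₁.move_mem k h s hs)
    have h2 := (hσ k (lastPos h) s hs).2
    simp only [selectorStrategy, ballInf]
    linarith
  have hI : ∀ η : ℝ, 0 < η → ∃ S₁ : Strategy n, ∀ S₂ : Strategy n,
      u x - η ≤ expectedPayoff hp hε Ω u x S₁ S₂ := by
    intro η hη
    choose σ hσm hσ using fun k : ℕ => exists_measurable_selector hB
      (show 0 < η / 2 * (1 / 2) ^ k by positivity)
    refine ⟨selectorStrategy σ hσm fun k x s hs => (hσ k x s hs).1, fun S₂ => ?_⟩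
    have := integral_payoff_le hn hp hε
      (selectorStrategy σ hσm fun k x s hs => (hσ k x s hs).1) S₂ hΩ hR hx hu.neg hBn
      (η := fun k => η / 2 * (1 / 2) ^ k) (fun k => by positivity)
      (hsum η hη) fun k h hh => by
        have hxΩ := lastPos_mem_of_alive hh
        have h0 : (-u) (lastPos h) = dpp p ε (fun y => -u y) (lastPos h) := by
          rw [dpp_neg, ← hdpp _ hxΩ, Pi.neg_apply]
        rw [h0]
        refine stepMean_le_dpp hp hε _ _ hu.neg hBn (by positivity) fun s hs => ?_
        have h1 := ballInf_le hB (S₂.move_mem k h s hs)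
        have h2 := (hσ k (lastPos h) s hs).2
        change -u _ + -u _ ≤ ballSup (fun y => -u y) _ s + ballInf (fun y => -u y) _ s + _
        rw [ballInf_neg]
        simp only [selectorStrategy]
        simp only [ballInf] at h1
        linarith
    change ∫ ω, payoff Ω ε (fun y => -u y) ω ∂_ ≤ -u x + η at this
    simp only [payoff_neg, integral_neg] at this
    unfold expectedPayoff
    linarith
  have hne : Nonempty (Strategy n) := ⟨(hI 1 one_pos).choose⟩
  have hlow : ∀ S₁, BddBelow (Set.range fun S₂ => expectedPayoff hp hε Ω u x S₁ S₂) := fun S₁ =>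
    ⟨-B, by rintro _ ⟨S₂, rfl⟩; exact (abs_le.1 (hbd S₁ S₂)).1⟩
  have hupp : ∀ S₂, BddAbove (Set.range fun S₁ => expectedPayoff hp hε Ω u x S₁ S₂) := fun S₂ =>
    ⟨B, by rintro _ ⟨S₁, rfl⟩; exact (abs_le.1 (hbd S₁ S₂)).2⟩
  unfold valueI valueII
  simp only [hexp]
  constructor
  · refine le_antisymm (le_of_forall_pos_le_add fun η hη => ?_)
      (le_of_forall_pos_le_add fun η hη => ?_)
    · obtain ⟨S₂, hS₂⟩ := hII η hη
      exact ciSup_le fun S₁ => (ciInf_le (hlow S₁) S₂).trans (hS₂ S₁)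
    · obtain ⟨S₁, hS₁⟩ := hI η hη
      have h1 : u x - η ≤ ⨅ S₂, expectedPayoff hp hε Ω u x S₁ S₂ := le_ciInf hS₁
      have h2 : BddAbove (Set.range fun S₁ => ⨅ S₂, expectedPayoff hp hε Ω u x S₁ S₂) :=
        ⟨B, by
          rintro _ ⟨S₁, rfl⟩
          exact (ciInf_le (hlow S₁) S₁).trans (abs_le.1 (hbd S₁ S₁)).2⟩
      linarith [le_ciSup h2 S₁]
  · refine le_antisymm (le_of_forall_pos_le_add fun η hη => ?_)
      (le_of_forall_pos_le_add fun η hη => ?_)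
    · obtain ⟨S₂, hS₂⟩ := hII η hη
      have h1 : ⨆ S₁, expectedPayoff hp hε Ω u x S₁ S₂ ≤ u x + η := ciSup_le hS₂
      have h2 : BddBelow (Set.range fun S₂ => ⨆ S₁, expectedPayoff hp hε Ω u x S₁ S₂) :=
        ⟨-B, by
          rintro _ ⟨S₂, rfl⟩
          exact (abs_le.1 (hbd S₂ S₂)).1.trans (le_ciSup (hupp S₂) S₂)⟩
      exact (ciInf_le h2 S₂).trans h1
    · obtain ⟨S₁, hS₁⟩ := hI η hη
      have h1 : u x - η ≤ ⨅ S₂, ⨆ S₁, expectedPayoff hp hε Ω u x S₁ S₂ :=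
        le_ciInf fun S₂ => (hS₁ S₂).trans (le_ciSup (hupp S₂) S₁)
      linarith


/-! ### The oscillation estimate. -/

/-- The average that turns the concavity of W in l into a gain, and the origin of the factor 3 in κ.
-/
theorem integral_sq_stepLaw {ε : ℝ} (hε : 0 < ε) : ∫ s, s ^ 2 ∂(stepLaw ε) = ε ^ 2 / 3 := by
  unfold stepLaw
  rw [ProbabilityTheory.cond, integral_smul_measure, integral_Icc_eq_integral_Ioc,
    ← intervalIntegral.integral_of_le hε.le, integral_pow, Real.volume_Icc, sub_zero,
    ENNReal.toReal_inv, ENNReal.toReal_ofReal hε.le, smul_eq_mul]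
  norm_num
  field_simp

/-- Comparison of a solution of the dynamic programming principle at two points: the noise is
coupled
by parallel translation, and the supremum at one point is paired with the infimum at the other. -/
theorem sub_le_of_dpp {n : ℕ} {p ε : ℝ} (hp : 2 < p) (hε : 0 < ε) {u : Space n → ℝ}
    (hu : Measurable u) {B : ℝ} (hB : ∀ x, |u x| ≤ B) {x y : Space n}
    (hx : u x = dpp p ε u x) (hy : u y = dpp p ε u y) {ψ : Space n → ℝ} {θ : ℝ → ℝ}
    (hψ : Integrable ψ (ballLaw n ε)) (hθ : Integrable θ (stepLaw ε))
    (h₁ : ∀ h, ‖h‖ < ε → u (x + h) - u (y + h) ≤ ψ h)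
    (h₂ : ∀ s, 0 < s → s ≤ ε →
      (ballSup u x s - ballInf u y s) + (ballInf u x s - ballSup u y s) ≤ θ s) :
    u x - u y ≤ beta n p * ∫ h, ψ h ∂(ballLaw n ε) + alpha n p / 2 * ∫ s, θ s ∂(stepLaw ε) := by
  have := isProbabilityMeasure_stepLaw hε
  have := isProbabilityMeasure_ballLaw (n := n) hε
  have ha := alpha_pos (n := n) hp
  have hb := beta_pos (n := n) hp
  have ib : ∀ x, Integrable (fun h => u (x + h)) (ballLaw n ε) := fun x =>
    integrable_of_bound (B := B) (by fun_prop) fun h => hB _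
  have is := integrable_ballSup_add_ballInf hε hB
  have e1 : ∫ h, u (x + h) ∂(ballLaw n ε) - ∫ h, u (y + h) ∂(ballLaw n ε) ≤
      ∫ h, ψ h ∂(ballLaw n ε) := by
    rw [← integral_sub (ib x) (ib y)]
    refine integral_mono_ae ((ib x).sub (ib y)) hψ ?_
    filter_upwards [ae_ballLaw n ε] with h hh using h₁ h hh
  have e2 : ∫ s, (ballSup u x s + ballInf u x s) ∂(stepLaw ε) -
      ∫ s, (ballSup u y s + ballInf u y s) ∂(stepLaw ε) ≤ ∫ s, θ s ∂(stepLaw ε) := by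
    rw [← integral_sub (is x) (is y)]
    refine integral_mono_ae ((is x).sub (is y)) hθ ?_
    filter_upwards [ae_stepLaw ε] with s hs
    have := h₂ s hs.1 hs.2
    linarith
  have e1' := mul_le_mul_of_nonneg_left e1 hb.le
  have e2' := mul_le_mul_of_nonneg_left e2 (half_pos ha).le
  rw [hx, hy]
  unfold dpp
  linarith

theorem ballSup_sub_ballInf_le {n : ℕ} {u : Space n → ℝ} {x y : Space n} {s c : ℝ} (hs : 0 < s)
    (h : ∀ x' ∈ ball x s, ∀ y' ∈ ball y s, u x' - u y' ≤ c) :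
    ballSup u x s - ballInf u y s ≤ c := by
  have : ballSup u x s ≤ ballInf u y s + c := by
    refine ballSup_le hs fun x' hx' => ?_
    have : u x' - c ≤ ballInf u y s := le_ballInf hs fun y' hy' => by linarith [h x' hx' y' hy']
    linarith
  linarith

/-- The comparison function for the oscillation of the value in the ball `B_l(z)`. -/
noncomputable def oscBound {n : ℕ} (a ε δ K κ M : ℝ) (c z : Space n) (l : ℝ) : ℝ :=
  2 * a * l + 5 * a * ε + δ * (K * l - κ * l ^ 2 + M * ‖z - c‖ ^ 2 + (K + κ) * ε)

/-- Growing and shrinking l by s balance in the linear terms; the concave term leaves a gain. -/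
theorem oscBound_add_add_oscBound_sub {n : ℕ} (a ε δ K κ M : ℝ) (c z : Space n) (l s : ℝ) :
    oscBound a ε δ K κ M c z (l + s) + oscBound a ε δ K κ M c z (l - s) =
      2 * oscBound a ε δ K κ M c z l - 2 * δ * κ * s ^ 2 := by
  unfold oscBound; ring

/-- Replaces the previous identity when l ≤ s, where the radius cannot shrink by s. The additive
terms 5aε and (K + κ)ε of W pay for the missing W(l - s); ε < 1 gives (s - l)² ≤ ε. -/
theorem oscBound_add_le {n : ℕ} {a ε δ K κ M : ℝ} (ha : 0 ≤ a) (hε : 0 < ε) (hε1 : ε < 1)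
    (hδ : 0 ≤ δ) (hK : 0 ≤ K) (hκ : 0 ≤ κ) (hM : 0 ≤ M) (c z : Space n) {l s : ℝ} (hl : 0 < l)
    (hls : l ≤ s) (hs : s ≤ ε) :
    oscBound a ε δ K κ M c z (l + s) ≤
      2 * oscBound a ε δ K κ M c z l - 2 * δ * κ * s ^ 2 := by
  have h1 : K * (s - l) ≤ K * ε := by gcongr; linarith
  have h2 : κ * (s - l) ^ 2 ≤ κ * ε := by
    gcongr
    nlinarith
  have h3 : 0 ≤ M * ‖z - c‖ ^ 2 := by positivity
  have h4 : 0 ≤ a * (2 * l + 5 * ε - 2 * s) := mul_nonneg ha (by linarith)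
  have h5 : 0 ≤ δ * (M * ‖z - c‖ ^ 2 + (K + κ) * ε - K * (s - l) - κ * (s - l) ^ 2) :=
    mul_nonneg hδ (by linarith)
  unfold oscBound
  linarith

theorem oscBound_translate_le {n : ℕ} {a ε δ K κ M : ℝ} (hδ : 0 ≤ δ) (hM : 0 ≤ M)
    (c z h : Space n) (l : ℝ) (hh : ‖h‖ ≤ ε) :
    oscBound a ε δ K κ M c (z + h) l ≤
      oscBound a ε δ K κ M c z l + δ * M * ε ^ 2 + 2 * δ * M * inner ℝ (z - c) h := by
  have h1 : ‖z + h - c‖ ^ 2 = ‖z - c‖ ^ 2 + 2 * inner ℝ (z - c) h + ‖h‖ ^ 2 := by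
    rw [← norm_add_sq_real]; congr 2; abel
  have h2 : ‖h‖ ^ 2 ≤ ε ^ 2 := by gcongr
  have h3 : 0 ≤ δ * M * (ε ^ 2 - ‖h‖ ^ 2) := by
    have : 0 ≤ ε ^ 2 - ‖h‖ ^ 2 := by linarith
    positivity
  unfold oscBound
  rw [h1]
  linarith

/-- M is chosen so that Mr² = 2, and K so that K - κl ≥ 2/r up to l = r + 1. The range beyond r is
needed because l + s may overshoot r by up to ε < 1. -/
theorem le_oscBound_of_exit {n : ℕ} {a ε δ K κ M r : ℝ} (ha : 0 ≤ a) (hε : 0 < ε)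
    (hδ : 0 ≤ δ) (hr : 0 < r) (hκ : 0 ≤ κ) (hM : M = 2 / r ^ 2)
    (hK : K = κ * (r + 1) + 2 / r) (c z : Space n) {l : ℝ} (hl : 0 < l) (hlr : l ≤ r + 1)
    (h : r ≤ ‖z - c‖ ∨ r ≤ l) : 2 * a * l + 2 * δ ≤ oscBound a ε δ K κ M c z l := by
  have h1 : 2 / r ≤ K - κ * l := by
    have : κ * l ≤ κ * (r + 1) := by gcongr
    linarith
  have h2 : 0 ≤ (K + κ) * ε := by subst hK; positivity
  have hr2 : 0 < 2 / r := by positivity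
  have h3 : 2 ≤ K * l - κ * l ^ 2 + M * ‖z - c‖ ^ 2 := by
    have e : K * l - κ * l ^ 2 = l * (K - κ * l) := by ring
    rw [e]
    rcases h with h | h
    · have h4 : 2 ≤ M * ‖z - c‖ ^ 2 := by
        calc (2 : ℝ) = M * r ^ 2 := by rw [hM]; field_simp
          _ ≤ _ := by
            have : 0 ≤ M := by rw [hM]; positivity
            gcongr
      have h5 : 0 ≤ l * (K - κ * l) := mul_nonneg hl.le (by linarith)
      linarith
    · have h4 : 2 ≤ l * (K - κ * l) := by
        calc (2 : ℝ) = r * (2 / r) := by field_simp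
          _ ≤ _ := by gcongr
      have h5 : 0 ≤ M * ‖z - c‖ ^ 2 := by subst hM; positivity
      linarith
  have h6 : 0 ≤ δ * (K * l - κ * l ^ 2 + M * ‖z - c‖ ^ 2 + (K + κ) * ε - 2) :=
    mul_nonneg hδ (by linarith)
  unfold oscBound
  have : 0 ≤ 5 * a * ε := by positivity
  linarith

theorem sub_le_of_near_affine {n : ℕ} {u : Space n → ℝ} {ν : Space n} {b δ : ℝ} {x y : Space n}
    (hx : |u x - inner ℝ ν x - b| ≤ δ) (hy : |u y - inner ℝ ν y - b| ≤ δ) :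
    u x - u y ≤ ‖ν‖ * ‖x - y‖ + 2 * δ := by
  have h := real_inner_le_norm ν (x - y)
  rw [inner_sub_right] at h
  linarith [(abs_le.1 hx).2, (abs_le.1 hy).1]

/-- A bound for the oscillation of a solution of the dynamic programming principle in balls improves
itself. -/
theorem oscillation_bound_improve {n : ℕ} {p ε : ℝ} (hp : 2 < p) (hε : 0 < ε) (hε1 : ε < 1)
    {Ω D : Set (Space n)} (hD : ∀ x ∈ Ω, ball x ε ⊆ D)
    {u : Space n → ℝ} (hu : Measurable u) {B : ℝ} (hB : ∀ x, |u x| ≤ B)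
    (hdpp : ∀ x ∈ Ω, u x = dpp p ε u x) {ν : Space n} {b δ : ℝ} (hδ : 0 ≤ δ)
    (hL : ∀ x ∈ D, |u x - inner ℝ ν x - b| ≤ δ) {c : Space n} {r : ℝ} (hr : 0 < r)
    (hc : ball c (2 * r) ⊆ Ω) {K κ M : ℝ} (hM : M = 2 / r ^ 2)
    (hκ : κ = 3 * (beta n p * M + 1) / alpha n p) (hK : K = κ * (r + 1) + 2 / r) {m : ℝ}
    (hm0 : 0 ≤ m)
    (hm : ∀ z l, ‖z - c‖ < r → 0 < l → l < r → ∀ x ∈ ball z l, ∀ y ∈ ball z l,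
      u x - u y ≤ oscBound ‖ν‖ ε δ K κ M c z l + m) :
    ∀ z l, ‖z - c‖ < r → 0 < l → l < r → ∀ x ∈ ball z l, ∀ y ∈ ball z l,
      u x - u y ≤ oscBound ‖ν‖ ε δ K κ M c z l + (m - δ * ε ^ 2) := by
  have := isProbabilityMeasure_stepLaw hε
  have := isProbabilityMeasure_ballLaw (n := n) hε
  have ha := alpha_pos (n := n) hp
  have hb := beta_pos (n := n) hp
  have hM0 : 0 ≤ M := by subst hM; positivity
  have hκ0 : 0 ≤ κ := by subst hκ; positivity
  have hK0 : 0 ≤ K := by subst hK; positivity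
  -- The hypothesis covers pairs (z, l) in the cylinder; for those that one round may reach outside
  -- it, closeness to the affine function suffices.
  have hext : ∀ z l, 0 < l → l ≤ r + 1 → ∀ x ∈ ball z l, ∀ y ∈ ball z l, x ∈ D → y ∈ D →
      u x - u y ≤ oscBound ‖ν‖ ε δ K κ M c z l + m := by
    intro z l hl hlr x hx y hy hxD hyD
    by_cases h : ‖z - c‖ < r ∧ l < r
    · exact hm z l h.1 hl h.2 x hx y hy
    · have h' : r ≤ ‖z - c‖ ∨ r ≤ l := by
        rcases not_and_or.1 h with h | h
        · exact Or.inl (not_lt.1 h)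
        · exact Or.inr (not_lt.1 h)
      have h1 := le_oscBound_of_exit (norm_nonneg ν) hε hδ hr hκ0 hM hK c z hl hlr h'
      have h2 := sub_le_of_near_affine (hL x hxD) (hL y hyD)
      have h3 : ‖x - y‖ ≤ 2 * l := by
        rw [← dist_eq_norm]
        have := dist_triangle_right x y z
        rw [mem_ball] at hx hy
        linarith
      have h4 := mul_le_mul_of_nonneg_left h3 (norm_nonneg ν)
      linarith
  intro z l hz hl hlr x hx y hy
  have hzΩ : ∀ w ∈ ball z l, w ∈ Ω := fun w hw => hc (by
    rw [mem_ball] at hw ⊢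
    have := dist_triangle w z c
    rw [dist_eq_norm z c] at this
    linarith)
  have hxΩ := hzΩ x hx
  have hyΩ := hzΩ y hy
  have hxz := mem_ball.1 hx
  have hyz := mem_ball.1 hy
  set W := oscBound ‖ν‖ ε δ K κ M c z l with hW
  have hi1 : Integrable (fun h => inner ℝ (z - c) h) (ballLaw n ε) :=
    integrable_ballLaw_of_continuous hε (by fun_prop)
  have hi2 : Integrable (fun s : ℝ => s ^ 2) (stepLaw ε) := by
    refine Integrable.of_bound (by fun_prop) (ε ^ 2) ?_
    filter_upwards [ae_stepLaw ε] with s hs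
    rw [Real.norm_of_nonneg (by positivity)]
    exact pow_le_pow_left₀ hs.1.le hs.2 2
  have key := sub_le_of_dpp hp hε hu hB (hdpp x hxΩ) (hdpp y hyΩ)
    (ψ := fun h => (W + m + δ * M * ε ^ 2) + 2 * δ * M * inner ℝ (z - c) h)
    (θ := fun s => 2 * (W + m) - 2 * δ * κ * s ^ 2)
    ((integrable_const _).add (hi1.const_mul _)) ((integrable_const _).sub (hi2.const_mul _))
    (fun h hh => by
      have h1 := hext (z + h) l hl (by linarith) (x + h) (by simpa using hx) (y + h)
        (by simpa using hy) (hD x hxΩ (by simpa using hh)) (hD y hyΩ (by simpa using hh))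
      have h2 := oscBound_translate_le (a := ‖ν‖) (K := K) (κ := κ) hδ hM0 c z h l hh.le
      linarith)
    (fun s hs hsε => by
      have h1 : ballSup u x s - ballInf u y s ≤ oscBound ‖ν‖ ε δ K κ M c z (l + s) + m := by
        refine ballSup_sub_ballInf_le hs fun x' hx' y' hy' => ?_
        refine hext z (l + s) (by linarith) (by linarith) x' ?_ y' ?_
          (hD x hxΩ (ball_subset_ball hsε hx')) (hD y hyΩ (ball_subset_ball hsε hy'))
        · rw [mem_ball] at hx' ⊢
          linarith [dist_triangle x' x z]
        · rw [mem_ball] at hy' ⊢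
          linarith [dist_triangle y' y z]
      rcases lt_or_ge s l with hsl | hsl
      · have h2 : ballInf u x s - ballSup u y s ≤ oscBound ‖ν‖ ε δ K κ M c z (l - s) + m := by
          have hls : 0 < l - s := by linarith
          obtain ⟨x', hx1, hx2⟩ := exists_dist_lt_lt hs hls (x := x) (z := z) (by linarith)
          obtain ⟨y', hy1, hy2⟩ := exists_dist_lt_lt hs hls (x := y) (z := z) (by linarith)
          have h3 := ballInf_le hB (mem_ball'.2 hx1)
          have h4 := le_ballSup hB (mem_ball'.2 hy1)
          have h5 := hm z (l - s) hz hls (by linarith) x' hx2 y' hy2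
          linarith
        have h3 := oscBound_add_add_oscBound_sub ‖ν‖ ε δ K κ M c z l s
        linarith
      · have h2 : ballInf u x s ≤ ballSup u y s :=
          (ballInf_le hB (mem_ball'.2 (by linarith))).trans
            (le_ballSup hB (mem_ball'.2 (by linarith : dist y z < s)))
        have h3 := oscBound_add_le (norm_nonneg ν) hε hε1 hδ hK0 hκ0 hM0 c z hl hsl hsε
        linarith)
  rw [integral_add (integrable_const _) (hi1.const_mul _), integral_const_mul,
    integral_inner_ballLaw, integral_sub (integrable_const _) (hi2.const_mul _),
    integral_const_mul, integral_const_mul, integral_sq_stepLaw hε] at key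
  simp only [integral_const, probReal_univ, smul_eq_mul, one_mul, mul_zero, add_zero] at key
  have hab := alpha_add_beta (n := n) hp
  -- The gain αδκε²/3 is exactly the noise cost βδMε² plus the improvement δε².
  have hκα : alpha n p * κ = 3 * (beta n p * M + 1) := by rw [hκ]; field_simp
  have e : beta n p * (W + m + δ * M * ε ^ 2) +
      alpha n p / 2 * (2 * (W + m) - 2 * δ * κ * (ε ^ 2 / 3)) = W + (m - δ * ε ^ 2) := by
    linear_combination (W + m) * hab - δ * ε ^ 2 / 3 * hκα
  linarith

theorem oscillation_bound {n : ℕ} {p ε : ℝ} (hp : 2 < p) (hε : 0 < ε) (hε1 : ε < 1)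
    {Ω D : Set (Space n)} (hD : ∀ x ∈ Ω, ball x ε ⊆ D)
    {u : Space n → ℝ} (hu : Measurable u) {B : ℝ} (hB : ∀ x, |u x| ≤ B)
    (hdpp : ∀ x ∈ Ω, u x = dpp p ε u x) {ν : Space n} {b δ : ℝ} (hδ : 0 < δ)
    (hL : ∀ x ∈ D, |u x - inner ℝ ν x - b| ≤ δ) {c : Space n} {r : ℝ} (hr : 0 < r)
    (hc : ball c (2 * r) ⊆ Ω) {K κ M : ℝ} (hM : M = 2 / r ^ 2)
    (hκ : κ = 3 * (beta n p * M + 1) / alpha n p) (hK : K = κ * (r + 1) + 2 / r) :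
    ∀ z l, ‖z - c‖ < r → 0 < l → l < r → ∀ x ∈ ball z l, ∀ y ∈ ball z l,
      u x - u y ≤ oscBound ‖ν‖ ε δ K κ M c z l := by
  have ha := alpha_pos (n := n) hp
  have hb := beta_pos (n := n) hp
  have hM0 : 0 ≤ M := by subst hM; positivity
  have hκ0 : 0 ≤ κ := by subst hκ; positivity
  -- The start m = 2B is trivial because W ≥ 0; each improvement removes the fixed amount δε² > 0
  -- until m reaches 0.
  have hind : ∀ k : ℕ, ∀ z l, ‖z - c‖ < r → 0 < l → l < r → ∀ x ∈ ball z l, ∀ y ∈ ball z l,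
      u x - u y ≤ oscBound ‖ν‖ ε δ K κ M c z l + max 0 (2 * B - k * (δ * ε ^ 2)) := by
    intro k
    induction k with
    | zero =>
      intro z l _ hl hlr x _ y _
      have h1 : 0 ≤ oscBound ‖ν‖ ε δ K κ M c z l := by
        have h2 : 0 ≤ l * (K - κ * l) := by
          refine mul_nonneg hl.le ?_
          have : κ * l ≤ κ * (r + 1) := by gcongr; linarith
          have : 0 < 2 / r := by positivity
          linarith
        have h3 : 0 ≤ (K + κ) * ε := by subst hK; positivity
        have h4 : 0 ≤ K * l - κ * l ^ 2 + M * ‖z - c‖ ^ 2 + (K + κ) * ε := by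
          have : 0 ≤ M * ‖z - c‖ ^ 2 := by positivity
          linarith
        unfold oscBound
        positivity
      have h2 : u x - u y ≤ 2 * B := by linarith [(abs_le.1 (hB x)).2, (abs_le.1 (hB y)).1]
      have h3 := le_max_right 0 (2 * B - ((0 : ℕ) : ℝ) * (δ * ε ^ 2))
      simp only [Nat.cast_zero, zero_mul, sub_zero] at h3 ⊢
      linarith
    | succ k ih =>
      intro z l hz hl hlr x hx y hy
      refine (oscillation_bound_improve hp hε hε1 hD hu hB hdpp hδ.le hL hr hc hM hκ hK
        (le_max_left _ _) ih z l hz hl hlr x hx y hy).trans ?_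
      gcongr
      have hδε : 0 < δ * ε ^ 2 := by positivity
      rw [sub_le_iff_le_add]
      refine max_le (by positivity) ?_
      have := le_max_right 0 (2 * B - ((k + 1 : ℕ) : ℝ) * (δ * ε ^ 2))
      push_cast at this ⊢
      linarith
  intro z l hz hl hlr x hx y hy
  obtain ⟨k, hk⟩ := exists_nat_ge (2 * B / (δ * ε ^ 2))
  rw [div_le_iff₀ (by positivity)] at hk
  have := hind k z l hz hl hlr x hx y hy
  rwa [max_eq_left (by linarith), add_zero] at this

theorem le_of_forall_gt_affine {A T t r g : ℝ} (ht : t < r) (hA : 0 ≤ A)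
    (h : ∀ l, t < l → l < r → g ≤ A * l + T) : g ≤ A * t + T := by
  refine le_of_forall_pos_le_add fun η hη => ?_
  have h1 : 0 < min (η / (A + 1)) ((r - t) / 2) := lt_min (by positivity) (by linarith)
  have h2 := h (t + min (η / (A + 1)) ((r - t) / 2)) (by linarith)
    (by linarith [min_le_right (η / (A + 1)) ((r - t) / 2)])
  have h3 : A * min (η / (A + 1)) ((r - t) / 2) ≤ η := by
    calc _ ≤ (A + 1) * (η / (A + 1)) := by
          gcongr
          · linarith
          · exact min_le_left _ _
      _ = η := by field_simp
  linarith

/-- Lipschitz estimate, up to the scale `ε`, for solutions of the dynamic programming principle that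
are close to an affine function. -/
theorem exists_lipschitz_const (n : ℕ) {p : ℝ} (hp : 2 < p) {r : ℝ} (hr : 0 < r) :
    ∃ C : ℝ, 0 < C ∧ ∀ (ε : ℝ), 0 < ε → ε < 1 → ∀ (Ω D : Set (Space n)),
      (∀ x ∈ Ω, ball x ε ⊆ D) → Ω ⊆ D → ∀ (u : Space n → ℝ), Measurable u →
      ∀ B : ℝ, (∀ x, |u x| ≤ B) → (∀ x ∈ Ω, u x = dpp p ε u x) →
      ∀ (ν : Space n) (b δ : ℝ), 0 ≤ δ → (∀ x ∈ D, |u x - inner ℝ ν x - b| ≤ δ) →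
      ∀ z₀ : Space n, ball z₀ (6 * r) ⊆ Ω → ∀ x ∈ ball z₀ r, ∀ y ∈ ball z₀ r,
        u x - u y ≤ (‖ν‖ + C * δ) * ‖x - y‖ + (5 * ‖ν‖ + C * δ) * ε := by
  have ha := alpha_pos (n := n) hp
  have hb := beta_pos (n := n) hp
  obtain ⟨M, hM⟩ : ∃ M, M = 2 / r ^ 2 := ⟨_, rfl⟩
  obtain ⟨κ, hκ⟩ : ∃ κ, κ = 3 * (beta n p * M + 1) / alpha n p := ⟨_, rfl⟩
  obtain ⟨K, hK⟩ : ∃ K, K = κ * (r + 1) + 2 / r := ⟨_, rfl⟩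
  have hM0 : 0 < M := by subst hM; positivity
  have hκ0 : 0 < κ := by subst hκ; positivity
  have hK0 : 0 < K := by subst hK; positivity
  refine ⟨K + κ, by positivity, ?_⟩
  intro ε hε hε1 Ω D hD hΩD u hu B hB hdpp ν b δ hδ hL z₀ hz₀ x hx y hy
  have hball : ball z₀ r ⊆ D := (ball_subset_ball (by linarith)).trans (hz₀.trans hΩD)
  -- For δ = 0 the improvement δε² vanishes, but then u is affine on D.
  rcases hδ.eq_or_lt with rfl | hδ'
  · have h1 := sub_le_of_near_affine (hL x (hball hx)) (hL y (hball hy))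
    have h2 : 0 ≤ 5 * ‖ν‖ * ε := by positivity
    linarith
  -- Centring at the midpoint removes the term M|z - c|² and lets l decrease to |x - y|/2, so 2‖ν‖l
  -- tends to ‖ν‖|x - y|. The remaining coefficients K/2 and K + κ are both at most C = K + κ.
  · set c := midpoint ℝ x y with hc
    have hcr : c ∈ ball z₀ r := (convex_ball z₀ r).midpoint_mem hx hy
    have hcΩ : ball c (2 * r) ⊆ Ω := (ball_subset_ball' (by
      rw [mem_ball] at hcr; linarith)).trans hz₀
    have hosc := oscillation_bound hp hε hε1 hD hu hB hdpp hδ' hL hr hcΩ hM hκ hK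
    have hxc : dist x c = ‖x - y‖ / 2 := by
      rw [hc, dist_left_midpoint, dist_eq_norm, Real.norm_ofNat]; ring
    have hyc : dist y c = ‖x - y‖ / 2 := by
      rw [hc, dist_right_midpoint, dist_eq_norm, Real.norm_ofNat]; ring
    have htr : ‖x - y‖ / 2 < r := by
      rw [← dist_eq_norm]
      rw [mem_ball] at hx hy
      linarith [dist_triangle_right x y z₀]
    have h := le_of_forall_gt_affine (A := 2 * ‖ν‖ + δ * K)
      (T := 5 * ‖ν‖ * ε + δ * ((K + κ) * ε)) (g := u x - u y) htr (by positivity)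
      fun l hl hlr => by
        have hl0 : 0 < l := lt_of_le_of_lt (by positivity) hl
        have h1 := hosc c l (by simpa using hr) hl0 hlr x (by rw [mem_ball, hxc]; exact hl) y
          (by rw [mem_ball, hyc]; exact hl)
        have h2 : 0 ≤ δ * (κ * l ^ 2) := by positivity
        rw [oscBound, sub_self, norm_zero] at h1
        linarith
    have h2 : 0 ≤ δ * (K / 2 + κ) * ‖x - y‖ := by positivity
    linarith

end TWN

/-! ### Assembly. -/

theorem theorem4p2 (n : ℕ) (hn : 2 ≤ n) (p : ℝ) (hp : 2 < p) (r : ℝ) (hr : 0 < r) :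
    ∃ C : ℝ, 0 < C ∧
      ∀ (Ω : Set (TWN.Space n)), IsOpen Ω → IsConnected Ω → Bornology.IsBounded Ω →
        TWN.UniformExteriorSphere Ω →
      ∀ (ε : ℝ) (hε : 0 < ε), ε < 1 →
      ∀ (ν : TWN.Space n) (b δ : ℝ) (F : TWN.Space n → ℝ),
        ContinuousOn F (TWN.strip Ω ε) →
        (∀ x ∈ TWN.strip Ω ε, |F x - inner ℝ ν x - b| ≤ δ) →
      ∀ z₀ : TWN.Space n, ball z₀ (6 * r) ⊆ Ω →
        -- the game has a value on `Ω_ε`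
        (∀ x ∈ Ω ∪ TWN.strip Ω ε, TWN.valueI hp hε Ω F x = TWN.valueII hp hε Ω F x) ∧
        ∀ x ∈ ball z₀ r, ∀ y ∈ ball z₀ r,
          |TWN.valueI hp hε Ω F x - TWN.valueI hp hε Ω F y| ≤
            (‖ν‖ + C * δ) * ‖x - y‖ + (5 * ‖ν‖ + C * δ) * ε := by
  classical
  obtain ⟨C, hC, hLip⟩ := TWN.exists_lipschitz_const n hp hr
  refine ⟨C, hC, ?_⟩
  intro Ω hΩo hΩc hΩb _ ε hε hε1 ν b δ F hF hFδ z₀ hz₀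
  have hΩ := hΩo.measurableSet
  have hstrip := TWN.measurableSet_strip hΩ ε
  obtain ⟨R, hR⟩ := hΩb.exists_norm_le
  have hclosure : ∀ x ∈ closure Ω, ‖x‖ ≤ R := fun x hx => by
    have : closure Ω ⊆ closedBall 0 R :=
      closure_minimal (fun x hx => by simpa using hR x hx) isClosed_closedBall
    simpa using this hx
  have hfr : (frontier Ω).Nonempty := by
    have : Nontrivial (TWN.Space n) := by
      have : Nontrivial (Fin n) := Fin.nontrivial_iff_two_le.2 hn
      have : Nonempty (Fin n) := inferInstance
      infer_instance
    refine nonempty_frontier_iff.2 ⟨hΩc.nonempty, fun h => ?_⟩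
    exact NormedSpace.unbounded_univ ℝ (TWN.Space n) (h ▸ hΩb)
  -- The strip contains the boundary of Ω, which is nonempty because Ω is nonempty and bounded.
  have hδ : 0 ≤ δ := by
    obtain ⟨w, hw⟩ := hfr
    have hws : w ∈ TWN.strip Ω ε := by
      refine ⟨fun h => ?_, by rw [infDist_zero_of_mem hw]; exact hε.le⟩
      rw [hΩo.frontier_eq] at hw
      exact hw.2 h
    exact (abs_nonneg _).trans (hFδ w hws)
  have hstripR : ∀ x ∈ TWN.strip Ω ε, ‖x‖ ≤ R + 2 := fun x hx => by
    obtain ⟨w, hw, hxw⟩ := (infDist_lt_iff hfr).1 (lt_of_le_of_lt hx.2 (by linarith : ε < 2))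
    rw [dist_eq_norm] at hxw
    have h1 := hclosure w (frontier_subset_closure hw)
    linarith [norm_le_norm_add_norm_sub' x w]
  -- Extension by zero gives measurable, bounded data on the whole space; one round started in Ω
  -- almost surely stays in Ω or the strip, so the extension does not affect the game.
  let Φ : TWN.Space n → ℝ := (TWN.strip Ω ε).piecewise F 0
  have hΦm : Measurable Φ := hF.measurable_piecewise continuousOn_const hstrip
  have hΦs : ∀ x ∈ TWN.strip Ω ε, Φ x = F x := fun x hx => Set.piecewise_eq_of_mem _ _ _ hx
  have hΦB : ∀ x, |Φ x| ≤ δ + ‖ν‖ * |R + 2| + |b| := fun x => by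
    by_cases hx : x ∈ TWN.strip Ω ε
    · rw [hΦs x hx]
      have h1 := hFδ x hx
      have h2 := abs_real_inner_le_norm ν x
      have h3 := mul_le_mul_of_nonneg_left ((hstripR x hx).trans (le_abs_self _))
        (norm_nonneg ν)
      have h4 : F x = (F x - inner ℝ ν x - b) + inner ℝ ν x + b := by ring
      rw [h4]
      refine (abs_add_three _ _ _).trans ?_
      linarith
    · have : Φ x = 0 := Set.piecewise_eq_of_notMem _ _ _ hx
      rw [this, abs_zero]
      positivity
  have hD : ∀ x ∈ Ω, ball x ε ⊆ Ω ∪ TWN.strip Ω ε := fun x hx => TWN.ball_subset_union_strip hx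
  obtain ⟨u, B, hum, huB, huΦ, hdpp, huL⟩ := TWN.exists_dpp_solution hn hp hε hΩ hR hD hΦm hΦB
    (ν := ν) (b := b) hδ (fun x hx hxΩ => by
      have hxs := hx.resolve_left hxΩ
      rw [hΦs x hxs]
      exact hFδ x hxs)
  have hval := fun x hx => TWN.valueI_valueII_eq_of_dpp hn hp hε hΩ hR (F := F) hum huB
    (fun x hx => by rw [huΦ x hx.1, hΦs x hx]) hdpp (x := x) hx
  refine ⟨fun x hx => by rw [(hval x hx).1, (hval x hx).2], fun x hx y hy => ?_⟩
  have hsub : ball z₀ r ⊆ Ω ∪ TWN.strip Ω ε :=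
    (ball_subset_ball (by linarith)).trans (hz₀.trans Set.subset_union_left)
  rw [(hval x (hsub hx)).1, (hval y (hsub hy)).1]
  have h := hLip ε hε hε1 Ω _ hD Set.subset_union_left u hum B huB hdpp ν b δ hδ huL z₀ hz₀
  have h1 := h x hx y hy
  have h2 := h y hy x hx
  rw [norm_sub_rev] at h2
  exact abs_le.2 ⟨by linarith, h1⟩
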